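/- Let $m>0$ and put $$m_1=\frac{-17+12\sqrt6}{23}>\frac12,\quad \varkappa(m)=23m^2+34m-25,\quad \alpha=\frac{m+7}{2(m+1)},\quad \beta=\frac{\sqrt{\varkappa(m)}}{2(m+1)}\ (m>m_1),\quad \lambda_{1,2}=\frac{m+7\pm\sqrt{-\varkappa(m)}}{2(m+1)}\ (m<m_1).$$ Consider the singular Cauchy problem, for $x>0$ near $0$, $$x^3Y'''+\frac{3(m-1)}{m+1}x^2Y''+\frac{6(m-1)}{m+1}xY'+6Y+\frac{6}{m+1}\bigl[m\,x^2Y''Y-(m-1)(xY')^2-2xY'Y+(m+1)Y^2\bigr]=0,\tag{1}$$ $$\lim_{x\to+0}Y=\lim_{x\to+0}xY'=\lim_{x\to+0}x^2Y''=0.\tag{2}$$ There is a family of functions $Y_m(x,C_1,C_2)$, $C_1,C_2\in\mathbb R$, such that for all $C_1,C_2$ the function $Y_m(\cdot,C_1,C_2)$ solves (1), (2) on an interval $(0,\delta)$ with $\delta=\delta(C_1,C_2)>0$; different pairs $(C_1,C_2)$ give functions that do not coincide on any interval $(0,\varepsilon)$; and for every $\tau_p\in\mathbb R$ the function $$\Phi(\tau)=\frac{6m}{(m+1)(\tau-\tau_p)}\bigl[1+Y_m(|\tau-\tau_p|,C_1,C_2)\bigr]$$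 solves $\Phi'''+\Phi\Phi''-\frac{m-1}{m}(\Phi')^2=0$ for $0<|\tau-\tau_p|<\delta$, with $\Phi\to\pm\infty$ as $\tau\to\tau_p\pm0$ (a three-parameter family of blow-up solutions, with parameters $\tau_p,C_1,C_2$). Moreover, as $x\to+0$: (i) if $m>m_1$, then $\alpha,\beta>0$ and $Y_m=x^{\alpha}\bigl[C_1\cos(\beta\ln x)+C_2\sin(\beta\ln x)+o(1)\bigr]$; (ii) if $m=m_1$, then $\alpha>0$ and $Y_m=x^{\alpha}\bigl[C_1+C_2\ln x\bigr]\bigl[1+o(1)\bigr]$; (iii) if $m<m_1$, then $\lambda_1>\lambda_2>0$ and $Y_m=\bigl[C_1x^{\lambda_1}+C_2x^{\lambda_2}\bigr]\bigl[1+o(1)\bigr]$. More precisely, for all $C_1,C_2$ and all sufficiently small $x>0$ (depending on $C_1,C_2$), $Y_m$ is the sum of an absolutely convergent Lyapunov series $$Y_m(x,C_1,C_2)=\sum_{k,l\ge0}c_1^k\,c_2^l\,x^{k\lambda+l\mu}\,q_{kl}(\ln x),\qquad q_{00}=0,$$ where the polynomials $q_{kl}$ depend only on $m$, and - for $m>m_1$: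 $\lambda=\alpha+i\beta$, $\mu=\alpha-i\beta$, $c_1=(C_1-iC_2)/2$, $c_2=(C_1+iC_2)/2$, $q_{10}=q_{01}=1$, and all $q_{kl}$ are (complex) constants; - for $m=m_1$: $\lambda=\mu=\alpha$, $c_i=C_i$, $q_{10}=1$, $q_{01}(s)=s$, and the $q_{kl}$ are real polynomials; - for $m<m_1$: $\lambda=\lambda_1$, $\mu=\lambda_2$, $c_i=C_i$, $q_{10}=q_{01}=1$, and the $q_{kl}$ are real polynomials, which are constants if $\lambda_1/\lambda_2$ is not an integer. Formal substitution of the series into (1) gives zero for each $(k,l)$, and this determines all the $q_{kl}$ uniquely, given the terms with $k+l\le1$ (in the exceptional case $m<m_1$, $\lambda_1=N\lambda_2$ with an integer $N\ge2$, after the normalization $q_{0N}(0)=0$, which only fixes the meaning of $C_1$). -/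

import Mathlib

open Filter Topology Asymptotics Polynomial

noncomputable section

namespace BlowUp

/-! ### Constants -/

/-- The critical value of the self-similarity parameter, `m₁ = (-17 + 12 √6) / 23`. -/
def mCrit : ℝ := (-17 + 12 * Real.sqrt 6) / 23

/-- `ϰ(m) = 23 m² + 34 m - 25`. -/
def kappa (m : ℝ) : ℝ := 23 * m ^ 2 + 34 * m - 25

/-- `α = (m + 7) / (2 (m + 1))`. -/
def alpha (m : ℝ) : ℝ := (m + 7) / (2 * (m + 1))

/-- `β = √ϰ(m) / (2 (m + 1))`; used for `m > m₁`. -/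
def beta (m : ℝ) : ℝ := Real.sqrt (kappa m) / (2 * (m + 1))

/-- `λ₁ = (m + 7 + √(-ϰ(m))) / (2 (m + 1))`; used for `m < m₁`. -/
def lam₁ (m : ℝ) : ℝ := (m + 7 + Real.sqrt (-kappa m)) / (2 * (m + 1))

/-- `λ₂ = (m + 7 - √(-ϰ(m))) / (2 (m + 1))`; used for `m < m₁`. -/
def lam₂ (m : ℝ) : ℝ := (m + 7 - Real.sqrt (-kappa m)) / (2 * (m + 1))

/-! ### The two differential problems -/

/-- The quadratic part `F(x, Y, x Y', x² Y'')` of the equation for `Y`,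
with `y₀ = Y`, `y₁ = x Y'`, `y₂ = x² Y''`. -/
def quadPart (m y₀ y₁ y₂ : ℝ) : ℝ :=
  6 / (m + 1) * (m * y₂ * y₀ - (m - 1) * y₁ ^ 2 - 2 * y₁ * y₀ + (m + 1) * y₀ ^ 2)

/-- `Y` is a solution on `(0, δ)` of the singular Cauchy problem
`x³Y''' + (3(m-1)/(m+1)) x²Y'' + (6(m-1)/(m+1)) xY' + 6Y + F(x, Y, xY', x²Y'') = 0`,
`Y, xY', x²Y'' → 0` as `x → +0`. -/
structure SolvesSingularCP (m δ : ℝ) (Y : ℝ → ℝ) : Prop where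
  smooth : ContDiffOn ℝ 3 Y (Set.Ioo 0 δ)
  eqn : ∀ x ∈ Set.Ioo 0 δ,
    x ^ 3 * iteratedDeriv 3 Y x + 3 * (m - 1) / (m + 1) * (x ^ 2 * iteratedDeriv 2 Y x)
      + 6 * (m - 1) / (m + 1) * (x * deriv Y x) + 6 * Y x
      + quadPart m (Y x) (x * deriv Y x) (x ^ 2 * iteratedDeriv 2 Y x) = 0
  tendsto_zero : Tendsto Y (𝓝[>] 0) (𝓝 0)
  tendsto_one : Tendsto (fun x => x * deriv Y x) (𝓝[>] 0) (𝓝 0)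
  tendsto_two : Tendsto (fun x => x ^ 2 * iteratedDeriv 2 Y x) (𝓝[>] 0) (𝓝 0)

/-- `Φ` is a solution of `Φ''' + Φ Φ'' - ((m-1)/m) (Φ')² = 0` on the punctured neighbourhood
`0 < |τ - τp| < δ` which blows up at `τp`. -/
structure IsBlowUpSolution (m τp δ : ℝ) (Φ : ℝ → ℝ) : Prop where
  smooth : ContDiffOn ℝ 3 Φ {τ | 0 < |τ - τp| ∧ |τ - τp| < δ}
  eqn : ∀ τ, 0 < |τ - τp| → |τ - τp| < δ →
    iteratedDeriv 3 Φ τ + Φ τ * iteratedDeriv 2 Φ τ - (m - 1) / m * (deriv Φ τ) ^ 2 = 0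
  blowup_right : Tendsto Φ (𝓝[>] τp) atTop
  blowup_left : Tendsto Φ (𝓝[<] τp) atBot

/-! ### Formal Lyapunov series

A family `q k l` of polynomials stands for the formal two-parameter series
`∑ c₁ᵏ c₂ˡ x ^ (k λ + l μ) q k l (ln x)`. -/

section Formal

variable {𝕜 : Type*} [Field 𝕜]

/-- Coefficients of `x Y'`, from `x (x^ρ q(ln x))' = x^ρ (ρ q + q')(ln x)`. -/
def xD (lam mu : 𝕜) (q : ℕ → ℕ → 𝕜[X]) (k l : ℕ) : 𝕜[X] :=
  C ((k : 𝕜) * lam + (l : 𝕜) * mu) * q k l + derivative (q k l)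

/-- Coefficients of `x² Y'' = x (x Y')' - x Y'`. -/
def xD2 (lam mu : 𝕜) (q : ℕ → ℕ → 𝕜[X]) (k l : ℕ) : 𝕜[X] :=
  xD lam mu (xD lam mu q) k l - xD lam mu q k l

/-- Coefficients of `x³ Y''' = x (x² Y'')' - 2 x² Y''`. -/
def xD3 (lam mu : 𝕜) (q : ℕ → ℕ → 𝕜[X]) (k l : ℕ) : 𝕜[X] :=
  xD lam mu (xD2 lam mu q) k l - 2 * xD2 lam mu q k l

/-- Coefficients of the (Cauchy) product of two formal series. -/
def conv (a b : ℕ → ℕ → 𝕜[X]) (k l : ℕ) : 𝕜[X] :=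
  ∑ i ∈ Finset.HasAntidiagonal.antidiagonal k, ∑ j ∈ Finset.HasAntidiagonal.antidiagonal l, a i.1 j.1 * b i.2 j.2

/-- `q` is the family of coefficients of a formal Lyapunov series for the equation for `Y` with
exponents `lam`, `mu` and principal term `c₁ x^lam + c₂ x^mu e(ln x)`: formal substitution of
the series into the equation gives zero identically in `c₁`, `c₂`. If `mu * l = lam` for some
`l ≥ 2`, the coefficient of `c₂ˡ x^lam` could be absorbed in the parameter `c₁` and is
normalized to be zero. -/
structure IsLyapunovCoeffs (m lam mu : 𝕜) (e : 𝕜[X]) (q : ℕ → ℕ → 𝕜[X]) : Prop where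
  zero : q 0 0 = 0
  principal₁ : q 1 0 = 1
  principal₂ : q 0 1 = e
  normalized : ∀ l : ℕ, 2 ≤ l → (l : 𝕜) * mu = lam → (q 0 l).coeff 0 = 0
  formal : ∀ k l : ℕ,
    xD3 lam mu q k l + C (3 * (m - 1) / (m + 1)) * xD2 lam mu q k l
      + C (6 * (m - 1) / (m + 1)) * xD lam mu q k l + 6 * q k l
      + C (6 / (m + 1)) * (C m * conv (xD2 lam mu q) q k l
          - C (m - 1) * conv (xD lam mu q) (xD lam mu q) k l
          - 2 * conv (xD lam mu q) q k l + C (m + 1) * conv q q k l) = 0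

end Formal

end BlowUp

end

open BlowUp

/-!
In the variable `u = ln x` the operator `x d/dx` becomes `D = d/du`, and the linear part of the
equation for `Y` factors as `(D + 1) (D - λ) (D - μ)`, where `λ + μ = (m + 7) / (m + 1)` and
`λ μ = 6` (`linear_part_eq`). The exponents `λ`, `μ` are a complex conjugate pair, a double root or
two distinct positive numbers according to the sign of `m - m₁`, and `Re λ, Re μ > 0` always.

*Formal solution.* On a term `e ^ (ρ u) p(u)` with `ρ = k λ + l μ` the linear part acts by
`p ↦ (ρ + 1 + D) (ρ - μ + D) (ρ - λ + D) p`, and `z + D` is bijective on polynomials for `z ≠ 0`.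
For `k + l ≥ 2` a factor degenerates only in the resonance `l μ = λ`, where the kernel consists of
the constants and is removed by the normalization. The quadratic part involves only coefficients of
smaller total index, so the coefficients are the unique fixed point of a recursion
(`Exponents.existsUnique_coeffs`). Without resonance the recursion stays within the constants.

*Convergence.* For `n = k + l` large the three factors are of size at least `c n`, while the degree
of `q k l` is at most `d n`. In a weighted `ℓ¹` norm in which differentiation is small on
polynomials of degree `d n` the linear part therefore gains `n³`, whereas the quadratic part loses
only `n²`. This gives a quadratic recursive inequality for the norms, hence geometric growth
(`geometric_of_quadratic_recursion`, `IsLyapunovCoeffs.geomBounded`); resonances concern finitely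
many indices and only influence the constants. Since the powers `e ^ (Re λ u)`, `e ^ (Re μ u)` beat
every power of `u` as `u → -∞`, the series converges absolutely, together with its derivatives, and
its sum solves the equation (`IsLyapunovCoeffs.series_equation`).

*Asymptotics.* The terms with `k + l ≥ 2` sum to something negligible against the principal term.
When `λ > μ` are real, an error of size `o(x ^ μ)` does not control the coefficient of `x ^ λ`; there
the terms with `k ≥ 1` are compared separately (`IsLyapunovCoeffs.series_sub_series_isLittleO`),
which yields both the asymptotics for `C₂ = 0` and the dependence on `C₁`.

*Blow-up.* The function `Φ` and its derivatives have the form `g(ln |τ - τp|) / (τ - τp) ^ k`, which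
is differentiated in the same way on both sides of `τp`, and the equation for `Φ` reduces to the
equation for `Y` (`LogSolution.isBlowUpSolution`).
-/

noncomputable section

namespace BlowUp

/-! ### Formal Lyapunov series: the recursion for the coefficients -/

section Algebra

variable {𝕜 : Type*} [Field 𝕜]

/-- The operator `p ↦ z p + p'` on polynomials: the action of `x d/dx` on `x ^ z p(ln x)`. -/
def shiftD (z : 𝕜) : 𝕜[X] →ₗ[𝕜] 𝕜[X] := z • LinearMap.id + derivative

lemma shiftD_apply (z : 𝕜) (p : 𝕜[X]) : shiftD z p = C z * p + derivative p := by
  simp [shiftD, smul_eq_C_mul]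

lemma xD_eq_shiftD (lam mu : 𝕜) (q : ℕ → ℕ → 𝕜[X]) (k l : ℕ) :
    xD lam mu q k l = shiftD ((k : 𝕜) * lam + (l : 𝕜) * mu) (q k l) := by
  rw [shiftD_apply, xD]

lemma natDegree_shiftD_le (z : 𝕜) (p : 𝕜[X]) : (shiftD z p).natDegree ≤ p.natDegree := by
  rw [shiftD_apply]
  exact (natDegree_add_le _ _).trans (max_le (natDegree_C_mul_le _ _)
    ((natDegree_derivative_le p).trans (Nat.sub_le _ _)))

lemma degree_shiftD {z : 𝕜} (hz : z ≠ 0) (p : 𝕜[X]) : (shiftD z p).degree = p.degree := by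
  rcases eq_or_ne p 0 with rfl | hp
  · simp
  rw [shiftD_apply, degree_add_eq_left_of_degree_lt, degree_C_mul hz]
  rw [degree_C_mul hz]
  exact degree_derivative_lt hp

lemma natDegree_shiftD {z : 𝕜} (hz : z ≠ 0) (p : 𝕜[X]) :
    (shiftD z p).natDegree = p.natDegree :=
  natDegree_eq_of_degree_eq (degree_shiftD hz p)

lemma shiftD_bijective {z : 𝕜} (hz : z ≠ 0) : Function.Bijective (shiftD z) := by
  constructor
  · rw [injective_iff_map_eq_zero]
    intro p hp
    rw [← degree_eq_bot, ← degree_shiftD hz, hp, degree_zero]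
  · rw [← LinearMap.range_eq_top, eq_top_iff]
    rintro p -
    have key : ∀ n : ℕ, (X ^ n : 𝕜[X]) ∈ LinearMap.range (shiftD z) := by
      intro n
      induction n with
      | zero => exact ⟨C z⁻¹, by simp [shiftD_apply, ← C_mul, hz]⟩
      | succ n ih =>
        have h1 : (X ^ (n + 1) : 𝕜[X]) = shiftD z (C z⁻¹ * X ^ (n + 1))
            - (z⁻¹ * (n + 1)) • X ^ n := by
          rw [shiftD_apply, ← mul_assoc, ← C_mul, mul_inv_cancel₀ hz, smul_eq_C_mul]
          simp
          ring
        rw [h1]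
        exact Submodule.sub_mem _ ⟨_, rfl⟩ (Submodule.smul_mem _ _ ih)
    induction p using Polynomial.induction_on' with
    | add p q hp hq => exact Submodule.add_mem _ hp hq
    | monomial n a =>
      rw [← C_mul_X_pow_eq_monomial, ← smul_eq_C_mul]
      exact Submodule.smul_mem _ _ (key n)

lemma existsUnique_derivative_eq [CharZero 𝕜] (g : 𝕜[X]) :
    ∃! p : 𝕜[X], derivative p = g ∧ p.coeff 0 = 0 := by
  have hex : ∃ p : 𝕜[X], derivative p = g ∧ p.coeff 0 = 0 := by
    induction g using Polynomial.induction_on' with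
    | add p q hp hq =>
      obtain ⟨a, ha, ha'⟩ := hp
      obtain ⟨b, hb, hb'⟩ := hq
      exact ⟨a + b, by simp [ha, hb], by simp [ha', hb']⟩
    | monomial n a =>
      refine ⟨monomial (n + 1) (a / (n + 1)), ?_, by simp [coeff_monomial]⟩
      have : (n : 𝕜) + 1 ≠ 0 := by exact_mod_cast Nat.succ_ne_zero n
      rw [derivative_monomial]
      congr 1
      push_cast
      field_simp
  obtain ⟨p, hp, hp0⟩ := hex
  refine ⟨p, ⟨hp, hp0⟩, ?_⟩
  rintro p' ⟨hp', hp0'⟩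
  have h : derivative (p' - p) = 0 := by simp [hp, hp']
  have h2 := eq_C_of_derivative_eq_zero h
  rw [coeff_sub, hp0, hp0'] at h2
  simpa [sub_eq_zero] using h2

/-- The linear part of the equation for `Y`, acting on the polynomial factor of
`x ^ ρ p(ln x)`, in factored form: the characteristic polynomial of the linear part is
`(ρ + 1) (ρ - lam) (ρ - mu)`. -/
def charOp (lam mu ρ : 𝕜) (p : 𝕜[X]) : 𝕜[X] :=
  shiftD (ρ + 1) (shiftD (ρ - mu) (shiftD (ρ - lam) p))

/-- Coefficients of the quadratic part of the equation for `Y`. -/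
def quadCoeff (m lam mu : 𝕜) (q : ℕ → ℕ → 𝕜[X]) (k l : ℕ) : 𝕜[X] :=
  C (6 / (m + 1)) * (C m * conv (xD2 lam mu q) q k l
    - C (m - 1) * conv (xD lam mu q) (xD lam mu q) k l
    - 2 * conv (xD lam mu q) q k l + C (m + 1) * conv q q k l)

/-- The algebraic properties of the exponents that make the recursion for the coefficients of the
series solvable: `lam` and `mu` are the roots of the characteristic polynomial other than `-1`,
and the only possible resonances among `k lam + l mu`, `k + l ≥ 2`, are `l mu = lam`. -/
structure Exponents (m lam mu : 𝕜) : Prop where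
  ne_zero : m + 1 ≠ 0
  sum : (m + 1) * (lam + mu) = m + 7
  prod : lam * mu = 6
  ne_neg_one : ∀ k l : ℕ, 2 ≤ k + l → (k : 𝕜) * lam + l * mu + 1 ≠ 0
  ne_mu : ∀ k l : ℕ, 2 ≤ k + l → (k : 𝕜) * lam + l * mu - mu ≠ 0
  resonance : ∀ k l : ℕ, 2 ≤ k + l → (k : 𝕜) * lam + l * mu - lam = 0 → k = 0

lemma linear_part_eq {m lam mu : 𝕜} (hm : m + 1 ≠ 0) (hs : (m + 1) * (lam + mu) = m + 7)
    (hp : lam * mu = 6) (q : ℕ → ℕ → 𝕜[X]) (k l : ℕ) :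
    xD3 lam mu q k l + C (3 * (m - 1) / (m + 1)) * xD2 lam mu q k l
      + C (6 * (m - 1) / (m + 1)) * xD lam mu q k l + 6 * q k l
      = charOp lam mu ((k : 𝕜) * lam + l * mu) (q k l) := by
  have h1 : 3 * (m - 1) / (m + 1) = 4 - lam - mu := by
    field_simp
    linear_combination hs
  have h2 : 6 * (m - 1) / (m + 1) = 8 - 2 * lam - 2 * mu := by
    field_simp
    linear_combination 2 * hs
  have h3 : (6 : 𝕜[X]) = C lam * C mu := by rw [← C_mul, hp]; rfl
  rw [h1, h2, charOp]
  generalize hr : (k : 𝕜) * lam + l * mu = r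
  simp only [xD3, xD2, xD, shiftD_apply, hr, map_add, map_sub, map_mul, derivative_mul,
    derivative_C, map_one, map_ofNat, derivative_zero]
  linear_combination (q k l + C r * q k l + derivative (q k l)) * h3

/-- A map on doubly indexed families whose `(k, l)` entry depends only on entries of smaller total
index has exactly one fixed point. -/
lemma existsUnique_fixedPoint {P : Type*} [Inhabited P] (Ψ : (ℕ → ℕ → P) → ℕ → ℕ → P)
    (hΨ : ∀ q q' k l, (∀ i j, i + j < k + l → q i j = q' i j) → Ψ q k l = Ψ q' k l) :
    ∃! q, Ψ q = q := by
  let s : ℕ → ℕ → ℕ → P := fun n => Ψ^[n] default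
  have hs : ∀ n, s (n + 1) = Ψ (s n) := fun n => Function.iterate_succ_apply' Ψ n default
  have hstab : ∀ n k l, k + l < n → s n k l = s (n + 1) k l := by
    intro n
    induction n with
    | zero => intro k l h; omega
    | succ n ih =>
      intro k l h
      rw [hs n, hs (n + 1)]
      exact hΨ _ _ _ _ fun i j hij => ih i j (by omega)
  have hstab' : ∀ n k l, k + l < n → s n k l = s (k + l + 1) k l := by
    intro n k l h
    induction n, h using Nat.le_induction with
    | base => rfl
    | succ n hn ih => rw [← hstab n k l hn, ih]
  refine ⟨fun k l => s (k + l + 1) k l, ?_, ?_⟩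
  · funext k l
    rw [hs]
    exact hΨ _ _ _ _ fun i j hij => (hstab' _ i j hij).symm
  · intro q hq
    have : ∀ n k l, k + l < n → q k l = s n k l := by
      intro n
      induction n with
      | zero => intro k l h; omega
      | succ n ih =>
        intro k l h
        rw [hs, ← congrFun (congrFun hq k) l]
        exact hΨ _ _ _ _ fun i j hij => ih i j (by omega)
    funext k l
    exact this _ k l (Nat.lt_succ_self _)

lemma conv_congr {a a' b b' : ℕ → ℕ → 𝕜[X]} {k l : ℕ} (ha : a 0 0 = 0) (ha' : a' 0 0 = 0)
    (hb : b 0 0 = 0) (hb' : b' 0 0 = 0) (haa : ∀ i j, i + j < k + l → a i j = a' i j)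
    (hbb : ∀ i j, i + j < k + l → b i j = b' i j) : conv a b k l = conv a' b' k l := by
  refine Finset.sum_congr rfl fun i hi => Finset.sum_congr rfl fun j hj => ?_
  rw [Finset.HasAntidiagonal.mem_antidiagonal] at hi hj
  rcases Nat.eq_zero_or_pos (i.1 + j.1) with h | h
  · have h1 : i.1 = 0 := by omega
    have h2 : j.1 = 0 := by omega
    rw [h1, h2, ha, ha', zero_mul, zero_mul]
  rcases Nat.eq_zero_or_pos (i.2 + j.2) with h' | h'
  · have h1 : i.2 = 0 := by omega
    have h2 : j.2 = 0 := by omega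
    rw [h1, h2, hb, hb', mul_zero, mul_zero]
  rw [haa _ _ (by omega), hbb _ _ (by omega)]

lemma xD_congr (lam mu : 𝕜) {q q' : ℕ → ℕ → 𝕜[X]} {k l : ℕ} (h : q k l = q' k l) :
    xD lam mu q k l = xD lam mu q' k l := by rw [xD, xD, h]

lemma xD2_congr (lam mu : 𝕜) {q q' : ℕ → ℕ → 𝕜[X]} {k l : ℕ} (h : q k l = q' k l) :
    xD2 lam mu q k l = xD2 lam mu q' k l := by
  rw [xD2, xD2, xD_congr lam mu (xD_congr lam mu h), xD_congr lam mu h]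

lemma xD_zero_zero (lam mu : 𝕜) {q : ℕ → ℕ → 𝕜[X]} (h : q 0 0 = 0) : xD lam mu q 0 0 = 0 := by
  simp [xD, h]

lemma xD2_zero_zero (lam mu : 𝕜) {q : ℕ → ℕ → 𝕜[X]} (h : q 0 0 = 0) :
    xD2 lam mu q 0 0 = 0 := by
  rw [xD2, xD_zero_zero lam mu (xD_zero_zero lam mu h), xD_zero_zero lam mu h, sub_zero]

/-- Since the constant term of the series vanishes, the quadratic part involves only
coefficients of smaller total index. -/
lemma quadCoeff_congr (m lam mu : 𝕜) {q q' : ℕ → ℕ → 𝕜[X]} {k l : ℕ} (h0 : q 0 0 = 0)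
    (h0' : q' 0 0 = 0) (h : ∀ i j, i + j < k + l → q i j = q' i j) :
    quadCoeff m lam mu q k l = quadCoeff m lam mu q' k l := by
  have h1 : ∀ i j, i + j < k + l → xD lam mu q i j = xD lam mu q' i j :=
    fun i j hij => xD_congr lam mu (h i j hij)
  have h2 : ∀ i j, i + j < k + l → xD2 lam mu q i j = xD2 lam mu q' i j :=
    fun i j hij => xD2_congr lam mu (h i j hij)
  have e0 := xD_zero_zero lam mu h0
  have e0' := xD_zero_zero lam mu h0'
  rw [quadCoeff, quadCoeff,
    conv_congr (xD2_zero_zero lam mu h0) (xD2_zero_zero lam mu h0') h0 h0' h2 h,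
    conv_congr e0 e0' e0 e0' h1 h1, conv_congr e0 e0' h0 h0' h1 h, conv_congr h0 h0' h0 h0' h h]

lemma conv_eq_zero {a b : ℕ → ℕ → 𝕜[X]} {k l : ℕ} (ha : a 0 0 = 0) (hb : b 0 0 = 0)
    (h : k + l < 2) : conv a b k l = 0 := by
  refine Finset.sum_eq_zero fun i hi => Finset.sum_eq_zero fun j hj => ?_
  rw [Finset.HasAntidiagonal.mem_antidiagonal] at hi hj
  rcases Nat.eq_zero_or_pos (i.1 + j.1) with h1 | h1
  · rw [show i.1 = 0 by omega, show j.1 = 0 by omega, ha, zero_mul]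
  · rw [show i.2 = 0 by omega, show j.2 = 0 by omega, hb, mul_zero]

lemma quadCoeff_eq_zero (m lam mu : 𝕜) {q : ℕ → ℕ → 𝕜[X]} {k l : ℕ} (h0 : q 0 0 = 0)
    (h : k + l < 2) : quadCoeff m lam mu q k l = 0 := by
  have e0 := xD_zero_zero lam mu h0
  rw [quadCoeff, conv_eq_zero (xD2_zero_zero lam mu h0) h0 h, conv_eq_zero e0 e0 h,
    conv_eq_zero e0 h0 h, conv_eq_zero h0 h0 h]
  simp

namespace Exponents

variable {m lam mu : 𝕜}

lemma formal_iff (hE : Exponents m lam mu) (q : ℕ → ℕ → 𝕜[X]) (k l : ℕ) :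
    xD3 lam mu q k l + C (3 * (m - 1) / (m + 1)) * xD2 lam mu q k l
      + C (6 * (m - 1) / (m + 1)) * xD lam mu q k l + 6 * q k l
      + C (6 / (m + 1)) * (C m * conv (xD2 lam mu q) q k l
          - C (m - 1) * conv (xD lam mu q) (xD lam mu q) k l
          - 2 * conv (xD lam mu q) q k l + C (m + 1) * conv q q k l) = 0 ↔
    charOp lam mu ((k : 𝕜) * lam + l * mu) (q k l) = - quadCoeff m lam mu q k l := by
  rw [linear_part_eq hE.ne_zero hE.sum hE.prod, ← quadCoeff, add_eq_zero_iff_eq_neg]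

/-- The recursion step: outside resonance the linear part is invertible on polynomials, and at a
resonance `l mu = lam` its kernel consists of the constants. -/
lemma existsUnique_charOp_eq [CharZero 𝕜] (hE : Exponents m lam mu) {k l : ℕ} (h : 2 ≤ k + l)
    (g : 𝕜[X]) : ∃! p : 𝕜[X], charOp lam mu ((k : 𝕜) * lam + l * mu) p = g ∧
      (k = 0 → (l : 𝕜) * mu = lam → p.coeff 0 = 0) := by
  have hb := (shiftD_bijective (hE.ne_neg_one k l h)).comp (shiftD_bijective (hE.ne_mu k l h))
  obtain ⟨g', hg'⟩ := hb.2 g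
  have hiff : ∀ p, charOp lam mu ((k : 𝕜) * lam + l * mu) p = g ↔
      shiftD ((k : 𝕜) * lam + l * mu - lam) p = g' := by
    intro p
    rw [← hb.1.eq_iff (a := shiftD ((k : 𝕜) * lam + l * mu - lam) p), hg']
    rfl
  simp only [hiff]
  by_cases hr : (k : 𝕜) * lam + l * mu - lam = 0
  · have hk := hE.resonance k l h hr
    subst hk
    have hl : (l : 𝕜) * mu = lam := by simpa [sub_eq_zero] using hr
    simpa [shiftD_apply, hl] using existsUnique_derivative_eq g'
  · obtain ⟨p, hp, hpu⟩ := (shiftD_bijective hr).existsUnique g'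
    refine ⟨p, ⟨hp, ?_⟩, fun p' hp' => hpu p' hp'.1⟩
    rintro rfl hl
    exact absurd (by simp [hl]) hr

theorem existsUnique_coeffs [CharZero 𝕜] (hE : Exponents m lam mu) {e : 𝕜[X]}
    (he : charOp lam mu mu e = 0) : ∃! q, IsLyapunovCoeffs m lam mu e q := by
  classical
  choose! S hS hSu using fun (k l : ℕ) (h : 2 ≤ k + l) (g : 𝕜[X]) =>
    hE.existsUnique_charOp_eq h g
  let tr : ℕ → (ℕ → ℕ → 𝕜[X]) → ℕ → ℕ → 𝕜[X] := fun n q i j =>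
    if 0 < i + j ∧ i + j < n then q i j else 0
  let Ψ : (ℕ → ℕ → 𝕜[X]) → ℕ → ℕ → 𝕜[X] := fun q k l =>
    if 2 ≤ k + l then S k l (- quadCoeff m lam mu (tr (k + l) q) k l)
    else if k = 1 then 1 else if l = 1 then e else 0
  have htr : ∀ (q : ℕ → ℕ → 𝕜[X]) k l, q 0 0 = 0 →
      quadCoeff m lam mu (tr (k + l) q) k l = quadCoeff m lam mu q k l := by
    intro q k l h0
    refine quadCoeff_congr m lam mu (by simp [tr]) h0 fun i j hij => ?_
    rcases Nat.eq_zero_or_pos (i + j) with h | h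
    · rw [show i = 0 by omega, show j = 0 by omega, h0]
      simp [tr]
    · simp only [tr, h, hij, and_self, if_true]
  have hiff : ∀ q, IsLyapunovCoeffs m lam mu e q ↔ Ψ q = q := by
    intro q
    constructor
    · intro hq
      funext k l
      by_cases h : 2 ≤ k + l
      · simp only [Ψ, h, if_true]
        symm
        refine hSu k l h _ (q k l) ⟨?_, ?_⟩
        · rw [htr q k l hq.zero]
          exact (hE.formal_iff q k l).1 (hq.formal k l)
        · rintro rfl hl
          exact hq.normalized l (by omega) hl
      · obtain ⟨rfl, rfl⟩ | ⟨rfl, rfl⟩ | ⟨rfl, rfl⟩ :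
          (k = 0 ∧ l = 0) ∨ (k = 1 ∧ l = 0) ∨ (k = 0 ∧ l = 1) := by omega
        · simp [Ψ, hq.zero]
        · simp [Ψ, hq.principal₁]
        · simp [Ψ, hq.principal₂]
    · intro hq
      have hq' : ∀ k l, q k l = Ψ q k l := fun k l => by rw [hq]
      have h00 : q 0 0 = 0 := by rw [hq']; simp [Ψ]
      have h10 : q 1 0 = 1 := by rw [hq']; simp [Ψ]
      have h01 : q 0 1 = e := by rw [hq']; simp [Ψ]
      have hrec : ∀ k l, 2 ≤ k + l → q k l = S k l (- quadCoeff m lam mu q k l) := by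
        intro k l h
        rw [hq', ← htr q k l h00]
        simp only [Ψ, h, if_true]
      refine ⟨h00, h10, h01, ?_, ?_⟩
      · intro l hl hlm
        rw [hrec 0 l (by omega)]
        exact (hS 0 l (by omega) _).2 rfl hlm
      · intro k l
        rw [hE.formal_iff]
        by_cases h : 2 ≤ k + l
        · conv_lhs => rw [hrec k l h]
          exact (hS k l h _).1
        · rw [quadCoeff_eq_zero m lam mu h00 (by omega)]
          obtain ⟨rfl, rfl⟩ | ⟨rfl, rfl⟩ | ⟨rfl, rfl⟩ :
            (k = 0 ∧ l = 0) ∨ (k = 1 ∧ l = 0) ∨ (k = 0 ∧ l = 1) := by omega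
          · simp [h00, charOp]
          · simp [h10, charOp, shiftD_apply]
          · simp [h01, he]
  simp only [hiff]
  refine existsUnique_fixedPoint Ψ fun q q' k l h => ?_
  have : tr (k + l) q = tr (k + l) q' := by
    funext i j
    simp only [tr]
    split_ifs with hij
    · exact h i j hij.2
    · rfl
  simp only [Ψ, this]

end Exponents

lemma charOp_one (lam mu : 𝕜) : charOp lam mu mu 1 = 0 := by
  simp [charOp, shiftD_apply]

lemma charOp_X (lam : 𝕜) : charOp lam lam lam X = 0 := by
  simp [charOp, shiftD_apply]

lemma natDegree_conv_le {a b : ℕ → ℕ → 𝕜[X]} {d k l : ℕ} (ha0 : a 0 0 = 0) (hb0 : b 0 0 = 0)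
    (ha : ∀ i j, i + j < k + l → (a i j).natDegree ≤ d * (i + j))
    (hb : ∀ i j, i + j < k + l → (b i j).natDegree ≤ d * (i + j)) :
    (conv a b k l).natDegree ≤ d * (k + l) := by
  refine natDegree_sum_le_of_forall_le _ _ fun i hi =>
    natDegree_sum_le_of_forall_le _ _ fun j hj => ?_
  rw [Finset.HasAntidiagonal.mem_antidiagonal] at hi hj
  rcases Nat.eq_zero_or_pos (i.1 + j.1) with h1 | h1
  · rw [show i.1 = 0 by omega, show j.1 = 0 by omega, ha0]; simp
  rcases Nat.eq_zero_or_pos (i.2 + j.2) with h2 | h2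
  · rw [show i.2 = 0 by omega, show j.2 = 0 by omega, hb0]; simp
  refine natDegree_mul_le.trans ((add_le_add (ha _ _ (by omega)) (hb _ _ (by omega))).trans ?_)
  rw [← hi, ← hj]
  exact le_of_eq (by ring)

/-- Degree bound for the coefficients: away from resonances the recursion does not raise the
degree above that of the products of earlier coefficients. -/
lemma IsLyapunovCoeffs.natDegree_le {m lam mu : 𝕜} {e : 𝕜[X]} {q : ℕ → ℕ → 𝕜[X]}
    (hE : Exponents m lam mu) (hq : IsLyapunovCoeffs m lam mu e q) {n₀ d : ℕ}
    (hsmall : ∀ k l, k + l < n₀ → (q k l).natDegree ≤ d * (k + l)) (hn₀ : 2 ≤ n₀)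
    (hres : ∀ k l : ℕ, n₀ ≤ k + l → (k : 𝕜) * lam + l * mu - lam ≠ 0) (k l : ℕ) :
    (q k l).natDegree ≤ d * (k + l) := by
  induction hn : k + l using Nat.strong_induction_on generalizing k l with
  | _ n ih =>
  subst hn
  by_cases h : k + l < n₀
  · exact hsmall k l h
  have hf := (hE.formal_iff q k l).1 (hq.formal k l)
  have h2 : 2 ≤ k + l := by omega
  have hdeg : (q k l).natDegree = (quadCoeff m lam mu q k l).natDegree := by
    rw [← natDegree_neg (quadCoeff m lam mu q k l), ← hf, charOp,
      natDegree_shiftD (hE.ne_neg_one k l h2), natDegree_shiftD (hE.ne_mu k l h2),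
      natDegree_shiftD (hres k l (by omega))]
  rw [hdeg]
  have b0 : ∀ i j, i + j < k + l → (q i j).natDegree ≤ d * (i + j) :=
    fun i j hij => ih (i + j) hij i j rfl
  have b1 : ∀ i j, i + j < k + l → (xD lam mu q i j).natDegree ≤ d * (i + j) := fun i j hij => by
    rw [xD_eq_shiftD]
    exact (natDegree_shiftD_le _ _).trans (b0 i j hij)
  have b2 : ∀ i j, i + j < k + l → (xD2 lam mu q i j).natDegree ≤ d * (i + j) :=
    fun i j hij => by
    rw [xD2, xD_eq_shiftD]
    exact (natDegree_sub_le _ _).trans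
      (max_le ((natDegree_shiftD_le _ _).trans (b1 i j hij)) (b1 i j hij))
  have e0 := xD_zero_zero lam mu hq.zero
  have c0 := natDegree_conv_le hq.zero hq.zero b0 b0
  have c1 := natDegree_conv_le e0 hq.zero b1 b0
  have c11 := natDegree_conv_le e0 e0 b1 b1
  have c2 := natDegree_conv_le (xD2_zero_zero lam mu hq.zero) hq.zero b2 b0
  have h2' : (2 : 𝕜[X]) = C 2 := rfl
  rw [quadCoeff, h2']
  refine (natDegree_C_mul_le _ _).trans ((natDegree_add_le _ _).trans (max_le
    ((natDegree_sub_le _ _).trans (max_le ((natDegree_sub_le _ _).trans (max_le ?_ ?_)) ?_)) ?_))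
  all_goals exact (natDegree_C_mul_le _ _).trans (by assumption)

section Map

variable {𝕂 : Type*} [Field 𝕂] (σ : 𝕜 →+* 𝕂)

lemma map_xD (lam mu : 𝕜) (q : ℕ → ℕ → 𝕜[X]) :
    xD (σ lam) (σ mu) (fun k l => (q k l).map σ) = fun k l => (xD lam mu q k l).map σ := by
  funext k l
  simp [xD, derivative_map]

lemma map_conv (a b : ℕ → ℕ → 𝕜[X]) :
    conv (fun k l => (a k l).map σ) (fun k l => (b k l).map σ)
      = fun k l => (conv a b k l).map σ := by
  funext k l
  simp [conv, Polynomial.map_sum]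

/-- Coefficient families are carried along by field homomorphisms. -/
lemma IsLyapunovCoeffs.map {m lam mu : 𝕜} {e : 𝕜[X]} {q : ℕ → ℕ → 𝕜[X]}
    (hq : IsLyapunovCoeffs m lam mu e q) :
    IsLyapunovCoeffs (σ m) (σ lam) (σ mu) (e.map σ) (fun k l => (q k l).map σ) := by
  have hD := map_xD σ lam mu q
  have hD2 : xD2 (σ lam) (σ mu) (fun k l => (q k l).map σ)
      = fun k l => (xD2 lam mu q k l).map σ := by
    funext k l
    simp only [xD2]
    rw [hD, map_xD]
    simp
  have hD3 : xD3 (σ lam) (σ mu) (fun k l => (q k l).map σ)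
      = fun k l => (xD3 lam mu q k l).map σ := by
    funext k l
    simp only [xD3]
    rw [hD2, map_xD]
    simp
  refine ⟨by simp [hq.zero], by simp [hq.principal₁], by simp [hq.principal₂], ?_, ?_⟩
  · intro l hl hlm
    rw [coeff_map, hq.normalized l hl (σ.injective (by simpa using hlm)), map_zero]
  · intro k l
    rw [hD3, hD2, hD, map_conv, map_conv, map_conv, map_conv]
    have := congrArg (Polynomial.map σ) (hq.formal k l)
    have h3 : σ 3 = 3 := map_ofNat σ 3
    have h6 : σ 6 = 6 := map_ofNat σ 6
    simpa [h3, h6] using this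

end Map

section Swap

lemma swap_xD (lam mu : 𝕜) (q : ℕ → ℕ → 𝕜[X]) :
    xD mu lam (fun k l => q l k) = fun k l => xD lam mu q l k := by
  funext k l
  simp only [xD]
  rw [add_comm ((k : 𝕜) * mu)]

lemma swap_conv (a b : ℕ → ℕ → 𝕜[X]) :
    conv (fun k l => a l k) (fun k l => b l k) = fun k l => conv a b l k := by
  funext k l
  exact Finset.sum_comm

/-- Exchanging the two exponents, when neither multiple `k lam`, `k ≥ 2`, equals `mu`. -/
lemma IsLyapunovCoeffs.swap {m lam mu : 𝕜} {q : ℕ → ℕ → 𝕜[X]}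
    (hq : IsLyapunovCoeffs m lam mu 1 q) (h : ∀ k : ℕ, 2 ≤ k → (k : 𝕜) * lam ≠ mu) :
    IsLyapunovCoeffs m mu lam 1 (fun k l => q l k) := by
  have hD := swap_xD lam mu q
  have hD2 : xD2 mu lam (fun k l => q l k) = fun k l => xD2 lam mu q l k := by
    funext k l
    simp only [xD2]
    rw [hD, swap_xD]
  have hD3 : xD3 mu lam (fun k l => q l k) = fun k l => xD3 lam mu q l k := by
    funext k l
    simp only [xD3]
    rw [hD2, swap_xD]
  refine ⟨hq.zero, hq.principal₂, hq.principal₁, fun l hl hlm => absurd hlm (h l hl), ?_⟩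
  intro k l
  rw [hD3, hD2, hD, swap_conv (xD2 lam mu q) q, swap_conv (xD lam mu q) (xD lam mu q),
    swap_conv (xD lam mu q) q, swap_conv q q]
  exact hq.formal l k

end Swap

end Algebra

/-! ### A weighted norm on polynomials -/

/-- The weighted `ℓ¹` norm `∑ ‖p_j‖ wʲ` of a polynomial. For large `w` differentiation is small in
this norm on polynomials of bounded degree. -/
def wnorm (w : ℝ) (p : ℂ[X]) : ℝ := p.sum fun i c => ‖c‖ * w ^ i

lemma wnorm_eq_sum_range (w : ℝ) (p : ℂ[X]) {n : ℕ} (hn : p.natDegree < n) :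
    wnorm w p = ∑ i ∈ Finset.range n, ‖p.coeff i‖ * w ^ i :=
  sum_over_range' p (fun i => by simp) n hn

lemma wnorm_zero (w : ℝ) : wnorm w 0 = 0 := by simp [wnorm]

lemma wnorm_nonneg {w : ℝ} (hw : 0 ≤ w) (p : ℂ[X]) : 0 ≤ wnorm w p :=
  Finset.sum_nonneg fun _ _ => by positivity

lemma wnorm_add_le {w : ℝ} (hw : 0 ≤ w) (p q : ℂ[X]) :
    wnorm w (p + q) ≤ wnorm w p + wnorm w q := by
  have h1 : p.natDegree < max p.natDegree q.natDegree + 1 := by omega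
  have h2 : q.natDegree < max p.natDegree q.natDegree + 1 := by omega
  have h3 : (p + q).natDegree < max p.natDegree q.natDegree + 1 :=
    Nat.lt_succ_of_le (natDegree_add_le p q)
  rw [wnorm_eq_sum_range w p h1, wnorm_eq_sum_range w q h2, wnorm_eq_sum_range w _ h3,
    ← Finset.sum_add_distrib]
  refine Finset.sum_le_sum fun i _ => ?_
  rw [coeff_add, ← add_mul]
  gcongr
  exact norm_add_le _ _

lemma wnorm_C_mul (w : ℝ) (z : ℂ) (p : ℂ[X]) : wnorm w (C z * p) = ‖z‖ * wnorm w p := by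
  rw [wnorm_eq_sum_range w p (Nat.lt_succ_self _),
    wnorm_eq_sum_range w _ (Nat.lt_succ_of_le (natDegree_C_mul_le z p)), Finset.mul_sum]
  refine Finset.sum_congr rfl fun i _ => ?_
  rw [coeff_C_mul, norm_mul, mul_assoc]

lemma wnorm_neg (w : ℝ) (p : ℂ[X]) : wnorm w (-p) = wnorm w p := by
  have := wnorm_C_mul w (-1) p
  simpa using this

lemma wnorm_sub_le {w : ℝ} (hw : 0 ≤ w) (p q : ℂ[X]) :
    wnorm w (p - q) ≤ wnorm w p + wnorm w q := by
  rw [sub_eq_add_neg, ← wnorm_neg w q]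
  exact wnorm_add_le hw _ _

lemma wnorm_sum_le {w : ℝ} (hw : 0 ≤ w) {ι : Type*} (s : Finset ι) (f : ι → ℂ[X]) :
    wnorm w (∑ i ∈ s, f i) ≤ ∑ i ∈ s, wnorm w (f i) :=
  Finset.le_sum_of_subadditive (wnorm w) (wnorm_zero w).le (wnorm_add_le hw) s f

lemma wnorm_mul_le {w : ℝ} (hw : 0 ≤ w) (p q : ℂ[X]) :
    wnorm w (p * q) ≤ wnorm w p * wnorm w q := by
  have hX : ∀ (n : ℕ) (r : ℂ[X]), wnorm w (X ^ n * r) = w ^ n * wnorm w r := by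
    intro n r
    rw [wnorm_eq_sum_range w r (Nat.lt_succ_self _),
      wnorm_eq_sum_range w (X ^ n * r) (n := n + (r.natDegree + 1)), Finset.sum_range_add,
      Finset.sum_eq_zero, zero_add, Finset.mul_sum]
    · refine Finset.sum_congr rfl fun i _ => ?_
      rw [add_comm n i, coeff_X_pow_mul, pow_add]
      ring
    · intro i hi
      rw [coeff_X_pow_mul', if_neg (by simpa using hi)]
      simp
    · have := natDegree_mul_le (p := (X ^ n : ℂ[X])) (q := r)
      have h2 := natDegree_X_pow_le (R := ℂ) n
      omega
  conv_lhs => rw [p.as_sum_support_C_mul_X_pow, Finset.sum_mul]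
  refine (wnorm_sum_le hw _ _).trans (le_of_eq ?_)
  rw [wnorm, Polynomial.sum, Finset.sum_mul]
  refine Finset.sum_congr rfl fun i _ => ?_
  rw [mul_assoc, wnorm_C_mul, hX, mul_assoc]

lemma wnorm_derivative_le {w : ℝ} (hw : 0 < w) {p : ℂ[X]} {d : ℕ} (hd : p.natDegree ≤ d) :
    wnorm w (derivative p) ≤ d / w * wnorm w p := by
  rw [wnorm_eq_sum_range w p (n := d + 1) (by omega),
    wnorm_eq_sum_range w _ (n := d + 1)
      (by have := natDegree_derivative_le p; omega), Finset.sum_range_succ,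
    Finset.sum_range_succ', mul_add, Finset.mul_sum]
  have h0 : (derivative p).coeff d = 0 := by
    rw [coeff_derivative, coeff_eq_zero_of_natDegree_lt (by omega), zero_mul]
  rw [h0]
  simp only [norm_zero, zero_mul]
  refine add_le_add (Finset.sum_le_sum fun i hi => ?_) (by positivity)
  rw [coeff_derivative, norm_mul, pow_succ]
  have hi' : ((i : ℝ) + 1) ≤ d := by
    have := Finset.mem_range.1 hi
    exact_mod_cast this
  have h1 : ‖((i : ℂ) + 1)‖ = (i : ℝ) + 1 := by
    have : ((i : ℂ) + 1) = ((i + 1 : ℕ) : ℂ) := by push_cast; ring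
    rw [this, Complex.norm_natCast]
    push_cast; ring
  rw [h1]
  have h2 : (d : ℝ) / w * (‖p.coeff (i + 1)‖ * (w ^ i * w)) = ‖p.coeff (i + 1)‖ * d * w ^ i := by
    field_simp
  rw [h2]
  gcongr

lemma wnorm_shiftD_le {w : ℝ} (hw : 0 < w) (z : ℂ) {p : ℂ[X]} {d : ℕ} (hd : p.natDegree ≤ d) :
    wnorm w (shiftD z p) ≤ (‖z‖ + d / w) * wnorm w p := by
  rw [shiftD_apply, add_mul, ← wnorm_C_mul]
  exact (wnorm_add_le hw.le _ _).trans (add_le_add le_rfl (wnorm_derivative_le hw hd))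

lemma le_wnorm_shiftD {w : ℝ} (hw : 0 < w) (z : ℂ) {p : ℂ[X]} {d : ℕ} (hd : p.natDegree ≤ d) :
    (‖z‖ - d / w) * wnorm w p ≤ wnorm w (shiftD z p) := by
  have h1 : C z * p = shiftD z p - derivative p := by rw [shiftD_apply]; ring
  have h2 := wnorm_sub_le hw.le (shiftD z p) (derivative p)
  rw [← h1, wnorm_C_mul] at h2
  have h3 := wnorm_derivative_le hw hd
  rw [sub_mul]
  linarith

lemma norm_eval_le_wnorm {r : ℝ} {u : ℂ} (hu : ‖u‖ ≤ r) (p : ℂ[X]) :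
    ‖p.eval u‖ ≤ wnorm r p := by
  rw [eval_eq_sum, wnorm]
  refine (norm_sum_le _ _).trans (Finset.sum_le_sum fun i _ => ?_)
  rw [norm_mul, norm_pow]
  dsimp only
  gcongr

lemma wnorm_mono {w w' : ℝ} (hw : 0 ≤ w) (h : w ≤ w') (p : ℂ[X]) : wnorm w p ≤ wnorm w' p :=
  Finset.sum_le_sum fun i _ => by dsimp only; gcongr

lemma wnorm_le_pow_mul {r : ℝ} (hr : 1 ≤ r) {p : ℂ[X]} {N : ℕ} (hN : p.natDegree ≤ N) :
    wnorm r p ≤ r ^ N * wnorm 1 p := by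
  rw [wnorm_eq_sum_range _ p (n := N + 1) (by omega),
    wnorm_eq_sum_range _ p (n := N + 1) (by omega), Finset.mul_sum]
  refine Finset.sum_le_sum fun i hi => ?_
  rw [one_pow, mul_one, mul_comm]
  have hi' : i ≤ N := Nat.lt_succ_iff.1 (Finset.mem_range.1 hi)
  gcongr

/-! ### The majorant inequality -/

lemma sum_antidiagonal_inv_sq_le (k : ℕ) :
    ∑ i ∈ Finset.HasAntidiagonal.antidiagonal k,
      (1 / ((i.1 : ℝ) + 1) ^ 2) * (1 / ((i.2 : ℝ) + 1) ^ 2) ≤ 8 * (1 / ((k : ℝ) + 1) ^ 2) := by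
  have hsum : ∀ n : ℕ, ∑ i ∈ Finset.range (n + 1), 1 / ((i : ℝ) + 1) ^ 2
      ≤ 2 - 1 / ((n : ℝ) + 1) := by
    intro n
    induction n with
    | zero => norm_num
    | succ n ih =>
      rw [Finset.sum_range_succ]
      have h : 1 / (((n + 1 : ℕ) : ℝ) + 1) ^ 2
          ≤ 1 / ((n : ℝ) + 1) - 1 / (((n + 1 : ℕ) : ℝ) + 1) := by
        push_cast
        rw [div_sub_div _ _ (by positivity) (by positivity),
          div_le_div_iff₀ (by positivity) (by positivity)]
        have : (0 : ℝ) ≤ n := by positivity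
        nlinarith
      linarith
  have h1 : ∑ i ∈ Finset.HasAntidiagonal.antidiagonal k, 1 / ((i.1 : ℝ) + 1) ^ 2 ≤ 2 := by
    have := Finset.Nat.sum_antidiagonal_eq_sum_range_succ_mk
      (fun i : ℕ × ℕ => 1 / ((i.1 : ℝ) + 1) ^ 2) k
    rw [this]
    have h2 : (0 : ℝ) ≤ 1 / ((k : ℝ) + 1) := by positivity
    linarith [hsum k]
  have h2 : ∑ i ∈ Finset.HasAntidiagonal.antidiagonal k, 1 / ((i.2 : ℝ) + 1) ^ 2 ≤ 2 := by
    rw [← Finset.Nat.sum_antidiagonal_swap] at h1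
    exact h1
  have h3 : ∀ i ∈ Finset.HasAntidiagonal.antidiagonal k,
      (1 / ((i.1 : ℝ) + 1) ^ 2) * (1 / ((i.2 : ℝ) + 1) ^ 2)
        ≤ 2 / ((k : ℝ) + 1) ^ 2 * (1 / ((i.1 : ℝ) + 1) ^ 2 + 1 / ((i.2 : ℝ) + 1) ^ 2) := by
    rintro ⟨i, j⟩ hij
    rw [Finset.HasAntidiagonal.mem_antidiagonal] at hij
    have hk : (k : ℝ) = i + j := by rw [← hij]; push_cast; ring
    rw [hk, div_add_div _ _ (by positivity) (by positivity), div_mul_div_comm, div_mul_div_comm,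
      div_le_div_iff₀ (by positivity) (by positivity)]
    have hi : (0 : ℝ) ≤ i := by positivity
    have hj : (0 : ℝ) ≤ j := by positivity
    have h4 : ((i : ℝ) + j + 1) ^ 2 ≤ 2 * (((i : ℝ) + 1) ^ 2 + ((j : ℝ) + 1) ^ 2) := by
      nlinarith [sq_nonneg ((i : ℝ) - j)]
    have h5 : (0 : ℝ) ≤ ((i : ℝ) + 1) ^ 2 * ((j : ℝ) + 1) ^ 2 := by positivity
    nlinarith [mul_le_mul_of_nonneg_left h4 h5]
  refine (Finset.sum_le_sum h3).trans ?_
  rw [← Finset.mul_sum, Finset.sum_add_distrib]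
  have h4 : (0 : ℝ) ≤ 2 / ((k : ℝ) + 1) ^ 2 := by positivity
  calc _ ≤ 2 / ((k : ℝ) + 1) ^ 2 * (2 + 2) := by gcongr
    _ = _ := by ring

/-- A quadratic recursive inequality forces at most geometric growth. The comparison function
`A Rᵏ⁺ˡ / ((k + 1)² (l + 1)²)` reproduces itself under the double Cauchy product; the finitely many
entries not covered by the recursion are absorbed in `R`. -/
lemma geometric_of_quadratic_recursion {N : ℕ → ℕ → ℝ} (hN : ∀ k l, 0 ≤ N k l) (hN0 : N 0 0 = 0)
    {K : ℝ} (hK : 0 ≤ K) {n₀ : ℕ} (hrec : ∀ k l, n₀ ≤ k + l →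
      N k l ≤ K * ∑ i ∈ Finset.HasAntidiagonal.antidiagonal k,
        ∑ j ∈ Finset.HasAntidiagonal.antidiagonal l, N i.1 j.1 * N i.2 j.2) :
    ∃ A R : ℝ, 0 ≤ A ∧ 1 ≤ R ∧ ∀ k l, N k l ≤ A * R ^ (k + l) := by
  set A : ℝ := 1 / (64 * (K + 1)) with hA
  have hA0 : 0 < A := by positivity
  let ω : ℕ → ℝ := fun k => 1 / ((k : ℝ) + 1) ^ 2
  have hω0 : ∀ k, 0 < ω k := fun k => by positivity
  have hω1 : ∀ k, ω k ≤ 1 := fun k => by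
    have : (0 : ℝ) ≤ k := by positivity
    exact (div_le_one (by positivity)).2 (by nlinarith)
  set R : ℝ := 1 + ∑ k ∈ Finset.range n₀, ∑ l ∈ Finset.range n₀, N k l / (A * ω k * ω l) with hR
  have hpos : ∀ k l, 0 ≤ N k l / (A * ω k * ω l) := fun k l =>
    div_nonneg (hN k l) (mul_nonneg (mul_nonneg hA0.le (hω0 k).le) (hω0 l).le)
  have hR1 : 1 ≤ R := by
    have : 0 ≤ ∑ k ∈ Finset.range n₀, ∑ l ∈ Finset.range n₀, N k l / (A * ω k * ω l) :=
      Finset.sum_nonneg fun k _ => Finset.sum_nonneg fun l _ => hpos k l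
    linarith
  have main : ∀ n k l, k + l = n → N k l ≤ A * R ^ (k + l) * (ω k * ω l) := by
    intro n
    induction n using Nat.strong_induction_on with
    | _ n ih =>
    intro k l hn
    have hRHS : 0 ≤ A * R ^ (k + l) * (ω k * ω l) := by
      have := hω0 k
      have := hω0 l
      positivity
    rcases Nat.eq_zero_or_pos n with h0 | h0
    · have hk : k = 0 := by omega
      have hl : l = 0 := by omega
      rw [hk, hl, hN0]
      rw [hk, hl] at hRHS
      exact hRHS
    by_cases hs : n < n₀
    · have h1 : N k l / (A * ω k * ω l) ≤ R := by
        have h2 : N k l / (A * ω k * ω l) ≤ ∑ l ∈ Finset.range n₀, N k l / (A * ω k * ω l) :=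
          Finset.single_le_sum (f := fun l => N k l / (A * ω k * ω l))
            (fun l _ => hpos k l) (Finset.mem_range.2 (by omega))
        have h3 : ∑ l ∈ Finset.range n₀, N k l / (A * ω k * ω l) ≤
            ∑ k ∈ Finset.range n₀, ∑ l ∈ Finset.range n₀, N k l / (A * ω k * ω l) :=
          Finset.single_le_sum
            (f := fun k => ∑ l ∈ Finset.range n₀, N k l / (A * ω k * ω l))
            (fun k _ => Finset.sum_nonneg fun l _ => hpos k l) (Finset.mem_range.2 (by omega))
        linarith
      have h2 : R ≤ R ^ (k + l) := le_self_pow₀ hR1 (by omega)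
      rw [div_le_iff₀ (mul_pos (mul_pos hA0 (hω0 k)) (hω0 l))] at h1
      refine h1.trans ?_
      have h3 : 0 ≤ A * ω k * ω l := (mul_pos (mul_pos hA0 (hω0 k)) (hω0 l)).le
      calc R * (A * ω k * ω l) ≤ R ^ (k + l) * (A * ω k * ω l) := by gcongr
        _ = _ := by ring
    · have hterm : ∀ i ∈ Finset.HasAntidiagonal.antidiagonal k,
          ∀ j ∈ Finset.HasAntidiagonal.antidiagonal l, N i.1 j.1 * N i.2 j.2 ≤
            (A ^ 2 * R ^ (k + l)) * ((ω i.1 * ω i.2) * (ω j.1 * ω j.2)) := by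
        rintro ⟨i, i'⟩ hi ⟨j, j'⟩ hj
        rw [Finset.HasAntidiagonal.mem_antidiagonal] at hi hj
        dsimp only at *
        have hnn : 0 ≤ (A ^ 2 * R ^ (k + l)) * ((ω i * ω i') * (ω j * ω j')) := by
          have := hω0 i
          have := hω0 i'
          have := hω0 j
          have := hω0 j'
          positivity
        rcases Nat.eq_zero_or_pos (i + j) with h | h
        · rw [show i = 0 by omega, show j = 0 by omega, hN0, zero_mul]
          rw [show i = 0 by omega, show j = 0 by omega] at hnn
          exact hnn
        rcases Nat.eq_zero_or_pos (i' + j') with h' | h'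
        · rw [show i' = 0 by omega, show j' = 0 by omega, hN0, mul_zero]
          rw [show i' = 0 by omega, show j' = 0 by omega] at hnn
          exact hnn
        have h1 := ih (i + j) (by omega) i j rfl
        have h2 := ih (i' + j') (by omega) i' j' rfl
        refine (mul_le_mul h1 h2 (hN _ _) ((hN _ _).trans h1)).trans (le_of_eq ?_)
        rw [← hi, ← hj]
        ring
      have hsum : ∑ i ∈ Finset.HasAntidiagonal.antidiagonal k,
          ∑ j ∈ Finset.HasAntidiagonal.antidiagonal l, N i.1 j.1 * N i.2 j.2 ≤
          (A ^ 2 * R ^ (k + l)) * ((8 * ω k) * (8 * ω l)) := by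
        refine (Finset.sum_le_sum fun i hi => Finset.sum_le_sum fun j hj =>
          hterm i hi j hj).trans ?_
        simp_rw [← Finset.mul_sum]
        rw [← Finset.sum_mul]
        have h1 := sum_antidiagonal_inv_sq_le k
        have h2 := sum_antidiagonal_inv_sq_le l
        have h3 : 0 ≤ ∑ i ∈ Finset.HasAntidiagonal.antidiagonal l, ω i.1 * ω i.2 :=
          Finset.sum_nonneg fun i _ => (mul_pos (hω0 _) (hω0 _)).le
        have h4 : 0 ≤ 8 * ω k := by
          have := hω0 k
          positivity
        exact mul_le_mul_of_nonneg_left (mul_le_mul h1 h2 h3 h4) (by positivity)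
      refine (hrec k l (by omega)).trans ((mul_le_mul_of_nonneg_left hsum hK).trans ?_)
      have hKA : K * (64 * A) ≤ 1 := by
        rw [hA]
        rw [mul_one_div, mul_div_assoc', div_le_one (by positivity)]
        linarith
      calc K * ((A ^ 2 * R ^ (k + l)) * ((8 * ω k) * (8 * ω l)))
          = (K * (64 * A)) * (A * R ^ (k + l) * (ω k * ω l)) := by ring
        _ ≤ 1 * (A * R ^ (k + l) * (ω k * ω l)) := by gcongr
        _ = _ := one_mul _
  refine ⟨A, R, hA0.le, hR1, fun k l => (main _ k l rfl).trans ?_⟩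
  have h1 : ω k * ω l ≤ 1 := mul_le_one₀ (hω1 k) (hω0 l).le (hω1 l)
  have h2 : 0 ≤ A * R ^ (k + l) := by positivity
  calc A * R ^ (k + l) * (ω k * ω l) ≤ A * R ^ (k + l) * 1 := by gcongr
    _ = _ := mul_one _

lemma wnorm_conv_le {w : ℝ} (hw : 0 ≤ w) {a b : ℕ → ℕ → ℂ[X]} {N : ℕ → ℕ → ℝ} {α β : ℝ} {k l : ℕ}
    (ha : ∀ i j, i + j ≤ k + l → wnorm w (a i j) ≤ α * N i j)
    (hb : ∀ i j, i + j ≤ k + l → wnorm w (b i j) ≤ β * N i j) :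
    wnorm w (conv a b k l) ≤ α * β * ∑ i ∈ Finset.HasAntidiagonal.antidiagonal k,
      ∑ j ∈ Finset.HasAntidiagonal.antidiagonal l, N i.1 j.1 * N i.2 j.2 := by
  rw [conv, Finset.mul_sum]
  refine (wnorm_sum_le hw _ _).trans (Finset.sum_le_sum fun i hi => ?_)
  rw [Finset.mul_sum]
  refine (wnorm_sum_le hw _ _).trans (Finset.sum_le_sum fun j hj => ?_)
  rw [Finset.HasAntidiagonal.mem_antidiagonal] at hi hj
  have h1 := ha i.1 j.1 (by omega)
  have h2 := hb i.2 j.2 (by omega)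
  refine (wnorm_mul_le hw _ _).trans ((mul_le_mul h1 h2 (wnorm_nonneg hw _)
    ((wnorm_nonneg hw _).trans h1)).trans (le_of_eq ?_))
  ring

lemma re_exponent_ge {a : ℝ} {lam mu : ℂ} (hlam : a ≤ lam.re) (hmu : a ≤ mu.re) (k l : ℕ) :
    a * ((k + l : ℕ) : ℝ) ≤ ((k : ℂ) * lam + l * mu).re := by
  have h1 : ((k : ℂ) * lam + l * mu).re = k * lam.re + l * mu.re := by simp
  rw [h1]
  push_cast
  have hk : (0 : ℝ) ≤ k := by positivity
  have hl : (0 : ℝ) ≤ l := by positivity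
  nlinarith [mul_le_mul_of_nonneg_left hlam hk, mul_le_mul_of_nonneg_left hmu hl]

lemma norm_exponent_le (lam mu : ℂ) (k l : ℕ) :
    ‖(k : ℂ) * lam + l * mu‖ ≤ (‖lam‖ + ‖mu‖) * ((k + l : ℕ) : ℝ) := by
  refine (norm_add_le _ _).trans ?_
  rw [norm_mul, norm_mul, Complex.norm_natCast, Complex.norm_natCast]
  push_cast
  have hk : (0 : ℝ) ≤ k := by positivity
  have hl : (0 : ℝ) ≤ l := by positivity
  nlinarith [mul_nonneg (norm_nonneg lam) hl, mul_nonneg (norm_nonneg mu) hk]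

/-- The quadratic part loses at most two powers of the index. -/
lemma wnorm_quadCoeff_le (m lam mu : ℂ) {q : ℕ → ℕ → ℂ[X]} {w B : ℝ} {d k l : ℕ} (hw : 1 ≤ w)
    (hB : 1 ≤ B) (hB' : ‖lam‖ + ‖mu‖ + d ≤ B)
    (hd : ∀ i j, (q i j).natDegree ≤ d * (i + j)) (hkl : 1 ≤ k + l) :
    wnorm w (quadCoeff m lam mu q k l) ≤
      ‖6 / (m + 1)‖ * (‖m‖ * (2 * B ^ 2) + ‖m - 1‖ * B ^ 2 + 2 * B + ‖m + 1‖)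
        * ((k + l : ℕ) : ℝ) ^ 2 * ∑ i ∈ Finset.HasAntidiagonal.antidiagonal k,
      ∑ j ∈ Finset.HasAntidiagonal.antidiagonal l, wnorm w (q i.1 j.1) * wnorm w (q i.2 j.2) := by
  have hw0 : 0 < w := by linarith
  set n : ℝ := ((k + l : ℕ) : ℝ) with hn
  have hn1 : 1 ≤ n := by rw [hn]; exact_mod_cast hkl
  set S := ∑ i ∈ Finset.HasAntidiagonal.antidiagonal k,
      ∑ j ∈ Finset.HasAntidiagonal.antidiagonal l, wnorm w (q i.1 j.1) * wnorm w (q i.2 j.2)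
    with hS
  have hS0 : 0 ≤ S := Finset.sum_nonneg fun i _ => Finset.sum_nonneg fun j _ =>
    mul_nonneg (wnorm_nonneg hw0.le _) (wnorm_nonneg hw0.le _)
  have step : ∀ (p : ℕ → ℕ → ℂ[X]), (∀ i j, (p i j).natDegree ≤ d * (i + j)) →
      ∀ i j, i + j ≤ k + l → wnorm w (xD lam mu p i j) ≤ B * n * wnorm w (p i j) := by
    intro p hp i j hij
    rw [xD_eq_shiftD]
    refine (wnorm_shiftD_le hw0 _ (hp i j)).trans
      (mul_le_mul_of_nonneg_right ?_ (wnorm_nonneg hw0.le _))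
    have h1 := norm_exponent_le lam mu i j
    have h2 : ((d * (i + j) : ℕ) : ℝ) / w ≤ d * ((i + j : ℕ) : ℝ) := by
      rw [Nat.cast_mul]
      exact div_le_self (by positivity) hw
    have h3 : ((i + j : ℕ) : ℝ) ≤ n := by rw [hn]; exact_mod_cast hij
    have h4 : (0 : ℝ) ≤ ((i + j : ℕ) : ℝ) := by positivity
    calc _ ≤ (‖lam‖ + ‖mu‖ + d) * ((i + j : ℕ) : ℝ) := by linarith
      _ ≤ B * n := by gcongr
  have hd1 : ∀ i j, (xD lam mu q i j).natDegree ≤ d * (i + j) := fun i j => by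
    rw [xD_eq_shiftD]
    exact (natDegree_shiftD_le _ _).trans (hd i j)
  have b0 : ∀ i j, i + j ≤ k + l → wnorm w (q i j) ≤ 1 * wnorm w (q i j) := by simp
  have b1 := step q hd
  have b2 : ∀ i j, i + j ≤ k + l →
      wnorm w (xD2 lam mu q i j) ≤ (2 * B ^ 2 * n ^ 2) * wnorm w (q i j) := by
    intro i j hij
    have h0 := wnorm_nonneg hw0.le (q i j)
    have h1 := b1 i j hij
    have h2 := step _ hd1 i j hij
    have hBn : 1 ≤ B * n := one_le_mul_of_one_le_of_one_le hB hn1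
    have h3 : B * n * wnorm w (xD lam mu q i j) ≤ B * n * (B * n * wnorm w (q i j)) := by
      gcongr
    have h4 := wnorm_sub_le hw0.le (xD lam mu (xD lam mu q) i j) (xD lam mu q i j)
    have h5 : B * n * wnorm w (q i j) ≤ (B * n) * (B * n * wnorm w (q i j)) :=
      le_mul_of_one_le_left (by positivity) hBn
    rw [xD2]
    nlinarith
  have c0 := wnorm_conv_le hw0.le b0 b0 
  have c1 := wnorm_conv_le hw0.le b1 b0
  have c11 := wnorm_conv_le hw0.le b1 b1
  have c2 := wnorm_conv_le hw0.le b2 b0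
  rw [← hS] at c0 c1 c11 c2
  have hC2 : (2 : ℂ[X]) = C 2 := rfl
  have hn2 : n ≤ n ^ 2 := le_self_pow₀ hn1 two_ne_zero
  have hn3 : 1 ≤ n ^ 2 := one_le_pow₀ hn1
  rw [quadCoeff, wnorm_C_mul, mul_assoc, mul_assoc]
  refine mul_le_mul_of_nonneg_left ?_ (norm_nonneg _)
  refine (wnorm_add_le hw0.le _ _).trans ((add_le_add ((wnorm_sub_le hw0.le _ _).trans
    (add_le_add (wnorm_sub_le hw0.le _ _) le_rfl)) le_rfl).trans ?_)
  rw [hC2, wnorm_C_mul, wnorm_C_mul, wnorm_C_mul, wnorm_C_mul, Complex.norm_ofNat]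
  have e2 : ‖m‖ * wnorm w (conv (xD2 lam mu q) q k l) ≤ ‖m‖ * (2 * B ^ 2 * n ^ 2 * 1 * S) := by
    gcongr
  have e11 : ‖m - 1‖ * wnorm w (conv (xD lam mu q) (xD lam mu q) k l)
      ≤ ‖m - 1‖ * (B * n * (B * n) * S) := by gcongr
  have e1 : 2 * wnorm w (conv (xD lam mu q) q k l) ≤ 2 * (B * n ^ 2 * 1 * S) := by
    refine mul_le_mul_of_nonneg_left (c1.trans ?_) zero_le_two
    gcongr
  have e0 : ‖m + 1‖ * wnorm w (conv q q k l) ≤ ‖m + 1‖ * (n ^ 2 * S) := by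
    refine mul_le_mul_of_nonneg_left (c0.trans ?_) (norm_nonneg _)
    gcongr
    linarith
  refine (add_le_add (add_le_add (add_le_add e2 e11) e1) e0).trans (le_of_eq ?_)
  ring

/-- Geometric bounds for a family of polynomials: the degrees grow at most linearly and the
coefficients at most geometrically in the total index. -/
def GeomBounded (p : ℕ → ℕ → ℂ[X]) : Prop :=
  ∃ (A R : ℝ) (d : ℕ), 0 ≤ A ∧ 0 ≤ R ∧ ∀ k l, (p k l).natDegree ≤ d * (k + l) ∧
    wnorm 1 (p k l) ≤ A * R ^ (k + l)

lemma GeomBounded.apply_xD {p : ℕ → ℕ → ℂ[X]} (hp : GeomBounded p) (lam mu : ℂ) :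
    GeomBounded (xD lam mu p) := by
  obtain ⟨A, R, d, hA, hR, h⟩ := hp
  refine ⟨(‖lam‖ + ‖mu‖ + d) * A, 2 * R, d, by positivity, by positivity, fun k l => ?_⟩
  obtain ⟨h1, h2⟩ := h k l
  rw [xD_eq_shiftD]
  refine ⟨(natDegree_shiftD_le _ _).trans h1, ?_⟩
  refine (wnorm_shiftD_le one_pos _ h1).trans ?_
  have h3 := norm_exponent_le lam mu k l
  have h4 : ((k + l : ℕ) : ℝ) ≤ 2 ^ (k + l) := by exact_mod_cast Nat.lt_two_pow_self.le
  have h5 : ‖(k : ℂ) * lam + l * mu‖ + ((d * (k + l) : ℕ) : ℝ) / 1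
      ≤ (‖lam‖ + ‖mu‖ + d) * 2 ^ (k + l) := by
    rw [div_one, Nat.cast_mul]
    calc _ ≤ (‖lam‖ + ‖mu‖ + d) * ((k + l : ℕ) : ℝ) := by linarith
      _ ≤ _ := by gcongr
  refine (mul_le_mul h5 h2 (wnorm_nonneg zero_le_one _) (by positivity)).trans (le_of_eq ?_)
  rw [mul_pow]
  ring

/-- The coefficients of a Lyapunov series are geometrically bounded when both exponents have
positive real part: the linear part gains three powers of the index, the quadratic part loses two.
Only finitely many indices are affected by resonances. -/
theorem IsLyapunovCoeffs.geomBounded {m lam mu : ℂ} {e : ℂ[X]} {q : ℕ → ℕ → ℂ[X]}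
    (hE : Exponents m lam mu) (hq : IsLyapunovCoeffs m lam mu e q) {a : ℝ} (ha : 0 < a)
    (hlam : a ≤ lam.re) (hmu : a ≤ mu.re) : GeomBounded q := by
  obtain ⟨n₁, hn₁⟩ := exists_nat_ge ((‖lam‖ + ‖mu‖) / (a / 2))
  set n₀ : ℕ := max 2 n₁ with hn₀
  have hbig : ∀ k l : ℕ, n₀ ≤ k + l → ‖lam‖ + ‖mu‖ ≤ a / 2 * ((k + l : ℕ) : ℝ) := by
    intro k l h
    have h1 : (n₁ : ℝ) ≤ ((k + l : ℕ) : ℝ) := by exact_mod_cast (le_max_right 2 n₁).trans h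
    rw [div_le_iff₀ (by positivity)] at hn₁
    nlinarith
  have hre := fun k l => re_exponent_ge hlam hmu k l
  have hlow : ∀ k l : ℕ, n₀ ≤ k + l → ∀ z : ℂ, ‖z‖ ≤ ‖lam‖ + ‖mu‖ →
      a / 2 * ((k + l : ℕ) : ℝ) ≤ ‖(k : ℂ) * lam + l * mu - z‖ := by
    intro k l h z hz
    have h1 := hbig k l h
    have h2 := (hre k l).trans (Complex.re_le_norm _)
    have h3 := norm_sub_norm_le ((k : ℂ) * lam + l * mu) z
    linarith
  have hlow1 : ∀ k l : ℕ, a / 2 * ((k + l : ℕ) : ℝ) ≤ ‖(k : ℂ) * lam + l * mu + 1‖ := by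
    intro k l
    have h1 := Complex.re_le_norm ((k : ℂ) * lam + l * mu + 1)
    rw [Complex.add_re, Complex.one_re] at h1
    have h2 := hre k l
    have h3 : 0 ≤ a / 2 * ((k + l : ℕ) : ℝ) := by positivity
    linarith
  set d : ℕ := ∑ k ∈ Finset.range n₀, ∑ l ∈ Finset.range n₀, (q k l).natDegree with hd
  have hpos : ∀ k l : ℕ, n₀ ≤ k + l → (0 : ℝ) < ((k + l : ℕ) : ℝ) := by
    intro k l h
    have : 2 ≤ k + l := (le_max_left 2 n₁).trans h
    exact_mod_cast (by omega : 0 < k + l)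
  have hdeg : ∀ k l, (q k l).natDegree ≤ d * (k + l) := by
    refine hq.natDegree_le hE (n₀ := n₀) (fun k l h => ?_) (le_max_left _ _) fun k l h h0 => ?_
    · rcases Nat.eq_zero_or_pos (k + l) with h0 | h0
      · rw [show k = 0 by omega, show l = 0 by omega, hq.zero]
        simp
      · have h1 : (q k l).natDegree ≤ ∑ l ∈ Finset.range n₀, (q k l).natDegree :=
          Finset.single_le_sum (f := fun l => (q k l).natDegree) (fun _ _ => Nat.zero_le _)
            (Finset.mem_range.2 (by omega))
        have h2 : ∑ l ∈ Finset.range n₀, (q k l).natDegree ≤ d :=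
          Finset.single_le_sum (f := fun k => ∑ l ∈ Finset.range n₀, (q k l).natDegree)
            (fun _ _ => Nat.zero_le _) (Finset.mem_range.2 (by omega))
        exact (h1.trans h2).trans (Nat.le_mul_of_pos_right _ h0)
    · have h1 := hlow k l h lam (by linarith [norm_nonneg mu])
      rw [h0, norm_zero] at h1
      have := mul_pos (half_pos ha) (hpos k l h)
      linarith
  set w : ℝ := 1 + 4 * d / a with hw
  have hw1 : 1 ≤ w := by
    have : 0 ≤ 4 * d / a := by positivity
    linarith
  have hw0 : 0 < w := by linarith
  have hdw : ∀ k l : ℕ, ((d * (k + l) : ℕ) : ℝ) / w ≤ a / 4 * ((k + l : ℕ) : ℝ) := by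
    intro k l
    rw [div_le_iff₀ hw0, Nat.cast_mul, hw]
    have h1 : a / 4 * ((k + l : ℕ) : ℝ) * (1 + 4 * d / a)
        = a / 4 * ((k + l : ℕ) : ℝ) + d * ((k + l : ℕ) : ℝ) := by
      field_simp
    rw [h1]
    have : 0 ≤ a / 4 * ((k + l : ℕ) : ℝ) := by positivity
    linarith
  set B : ℝ := 1 + (‖lam‖ + ‖mu‖ + d) with hB
  have hB1 : 1 ≤ B := by
    have : 0 ≤ ‖lam‖ + ‖mu‖ + d := by positivity
    linarith
  set K : ℝ := ‖6 / (m + 1)‖ * (‖m‖ * (2 * B ^ 2) + ‖m - 1‖ * B ^ 2 + 2 * B + ‖m + 1‖) with hK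
  have hK0 : 0 ≤ K := by positivity
  have hrec : ∀ k l, n₀ ≤ k + l → wnorm w (q k l) ≤ (K / (a / 4) ^ 3) *
      ∑ i ∈ Finset.HasAntidiagonal.antidiagonal k, ∑ j ∈ Finset.HasAntidiagonal.antidiagonal l,
        wnorm w (q i.1 j.1) * wnorm w (q i.2 j.2) := by
    intro k l h
    have hn1 : 1 ≤ k + l := by
      have : 2 ≤ k + l := (le_max_left 2 n₁).trans h
      omega
    have hquad := wnorm_quadCoeff_le m lam mu hw1 hB1 (by linarith) hdeg hn1
    rw [← hK] at hquad
    have hf := (hE.formal_iff q k l).1 (hq.formal k l)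
    rw [← wnorm_neg, ← hf, charOp] at hquad
    set n : ℝ := ((k + l : ℕ) : ℝ) with hn
    have hn0 : 0 < n := hpos k l h
    have hn1' : 1 ≤ n := by rw [hn]; exact_mod_cast hn1
    set S := ∑ i ∈ Finset.HasAntidiagonal.antidiagonal k,
      ∑ j ∈ Finset.HasAntidiagonal.antidiagonal l, wnorm w (q i.1 j.1) * wnorm w (q i.2 j.2)
    have low : ∀ (z : ℂ) (p : ℂ[X]), a / 2 * n ≤ ‖z‖ → p.natDegree ≤ d * (k + l) →
        a / 4 * n * wnorm w p ≤ wnorm w (shiftD z p) := by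
      intro z p hz hp
      refine le_trans (mul_le_mul_of_nonneg_right ?_ (wnorm_nonneg hw0.le p))
        (le_wnorm_shiftD hw0 z hp)
      linarith [hdw k l]
    have d1 := (natDegree_shiftD_le ((k : ℂ) * lam + l * mu - lam) (q k l)).trans (hdeg k l)
    have d2 := (natDegree_shiftD_le ((k : ℂ) * lam + l * mu - mu) _).trans d1
    have l1 := low _ _ (hlow k l h lam (by linarith [norm_nonneg mu])) (hdeg k l)
    have l2 := low _ _ (hlow k l h mu (by linarith [norm_nonneg lam])) d1
    have l3 := low _ _ (hlow1 k l) d2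
    have han : 0 ≤ a / 4 * n := by positivity
    have l4 : (a / 4 * n) ^ 3 * wnorm w (q k l) ≤ K * n ^ 2 * S := by
      calc (a / 4 * n) ^ 3 * wnorm w (q k l)
          = a / 4 * n * (a / 4 * n * (a / 4 * n * wnorm w (q k l))) := by ring
        _ ≤ a / 4 * n * (a / 4 * n * wnorm w _) := by gcongr
        _ ≤ a / 4 * n * wnorm w _ := by gcongr
        _ ≤ _ := l3
        _ ≤ _ := hquad
    have l5 : (a / 4) ^ 3 * n * wnorm w (q k l) ≤ K * S := by
      have h1 : n ^ 2 * ((a / 4) ^ 3 * n * wnorm w (q k l)) ≤ n ^ 2 * (K * S) := by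
        calc _ = (a / 4 * n) ^ 3 * wnorm w (q k l) := by ring
          _ ≤ _ := l4
          _ = _ := by ring
      exact le_of_mul_le_mul_left h1 (by positivity)
    rw [div_mul_eq_mul_div, le_div_iff₀ (by positivity)]
    refine le_trans ?_ l5
    have h1 : 0 ≤ (a / 4) ^ 3 * wnorm w (q k l) :=
      mul_nonneg (by positivity) (wnorm_nonneg hw0.le _)
    nlinarith
  obtain ⟨A, R, hA, hR, hAR⟩ := geometric_of_quadratic_recursion
    (fun k l => wnorm_nonneg hw0.le (q k l)) (by rw [hq.zero, wnorm_zero]) (by positivity) hrec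
  exact ⟨A, R, d, hA, by linarith, fun k l => ⟨hdeg k l,
    (wnorm_mono zero_le_one hw1 _).trans (hAR k l)⟩⟩

/-! ### Convergence, differentiation and multiplication of Lyapunov series -/

/-- The `(k, l)` term of the Lyapunov series with coefficients `p`, in the variable `u = ln x`. -/
def term (lam mu c₁ c₂ : ℂ) (p : ℕ → ℕ → ℂ[X]) (u : ℝ) (n : ℕ × ℕ) : ℂ :=
  c₁ ^ n.1 * c₂ ^ n.2 * Complex.exp (((n.1 : ℂ) * lam + n.2 * mu) * u) *
    (p n.1 n.2).eval (u : ℂ)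

/-- The sum of the Lyapunov series with coefficients `p`, in the variable `u = ln x`. -/
def series (lam mu c₁ c₂ : ℂ) (p : ℕ → ℕ → ℂ[X]) (u : ℝ) : ℂ :=
  ∑' n, term lam mu c₁ c₂ p u n

/-- The quantity whose powers dominate the terms of a geometrically bounded series. -/
def theta (R : ℝ) (d : ℕ) (c lam : ℂ) (u : ℝ) : ℝ :=
  R * ‖c‖ * (Real.exp (lam.re * u) * (1 + |u|) ^ d)

lemma theta_nonneg {R : ℝ} (hR : 0 ≤ R) (d : ℕ) (c lam : ℂ) (u : ℝ) : 0 ≤ theta R d c lam u := by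
  unfold theta
  positivity

lemma tendsto_exp_mul_pow_atBot {a : ℝ} (ha : 0 < a) (d : ℕ) :
    Tendsto (fun u : ℝ => Real.exp (a * u) * (1 + |u|) ^ d) atBot (𝓝 0) := by
  have h1 : Tendsto (fun v : ℝ => v ^ d / Real.exp (a * v)) atTop (𝓝 0) :=
    (isLittleO_pow_exp_pos_mul_atTop d ha).tendsto_div_nhds_zero
  have h2 : Tendsto (fun u : ℝ => 1 + |u|) atBot atTop :=
    tendsto_atTop_add_const_left _ _ tendsto_abs_atBot_atTop
  have h3 := (h1.comp h2).const_mul (Real.exp a)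
  rw [mul_zero] at h3
  refine h3.congr' ?_
  filter_upwards [eventually_le_atBot (0 : ℝ)] with u hu
  simp only [Function.comp_apply]
  rw [abs_of_nonpos hu, show a * (1 + -u) = a - a * u by ring, Real.exp_sub]
  field_simp

lemma tendsto_theta (R : ℝ) (d : ℕ) (c : ℂ) {lam : ℂ} (h : 0 < lam.re) :
    Tendsto (theta R d c lam) atBot (𝓝 0) := by
  have := (tendsto_exp_mul_pow_atBot h d).const_mul (R * ‖c‖)
  rw [mul_zero] at this
  exact this

lemma GeomBounded.norm_term_le {p : ℕ → ℕ → ℂ[X]} (hp : GeomBounded p) (lam mu : ℂ) :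
    ∃ (A R : ℝ) (d : ℕ), 0 ≤ A ∧ 0 ≤ R ∧ ∀ c₁ c₂ u n, ‖term lam mu c₁ c₂ p u n‖ ≤
      A * (theta R d c₁ lam u ^ n.1 * theta R d c₂ mu u ^ n.2) := by
  obtain ⟨A, R, d, hA, hR, h⟩ := hp
  refine ⟨A, R, d, hA, hR, ?_⟩
  rintro c₁ c₂ u ⟨k, l⟩
  obtain ⟨h1, h2⟩ := h k l
  have hu : ‖(u : ℂ)‖ ≤ 1 + |u| := by
    rw [Complex.norm_real, Real.norm_eq_abs]
    linarith
  have h3 : ‖(p k l).eval (u : ℂ)‖ ≤ (1 + |u|) ^ (d * (k + l)) * (A * R ^ (k + l)) := by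
    refine (norm_eval_le_wnorm hu _).trans ((wnorm_le_pow_mul ?_ h1).trans ?_)
    · linarith [abs_nonneg u]
    · gcongr
  have h4 : ‖Complex.exp (((k : ℂ) * lam + l * mu) * u)‖
      = Real.exp (lam.re * u) ^ k * Real.exp (mu.re * u) ^ l := by
    rw [Complex.norm_exp, ← Real.exp_nat_mul, ← Real.exp_nat_mul, ← Real.exp_add]
    congr 1
    simp
    ring
  simp only [term, theta]
  rw [norm_mul, norm_mul, norm_mul, norm_pow, norm_pow, h4]
  calc _ ≤ ‖c₁‖ ^ k * ‖c₂‖ ^ l * (Real.exp (lam.re * u) ^ k * Real.exp (mu.re * u) ^ l)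
        * ((1 + |u|) ^ (d * (k + l)) * (A * R ^ (k + l))) := by gcongr
    _ = _ := by
      rw [pow_mul]
      simp only [mul_pow, pow_add]
      ring

lemma hasSum_half_pow : HasSum (fun n : ℕ × ℕ => (1 / 2 : ℝ) ^ (n.1 + n.2)) 4 := by
  have h := hasSum_geometric_two.mul hasSum_geometric_two
    (hasSum_geometric_two.summable.mul_of_nonneg hasSum_geometric_two.summable
      (fun n => by positivity) (fun n => by positivity))
  rw [show (2 : ℝ) * 2 = 4 by norm_num] at h
  simpa only [pow_add] using h

lemma pow_mul_pow_le_half {x y : ℝ} (hx : 0 ≤ x) (hy : 0 ≤ y) (hx' : x ≤ 1 / 2)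
    (hy' : y ≤ 1 / 2) (k l : ℕ) : x ^ k * y ^ l ≤ (1 / 2) ^ (k + l) := by
  rw [pow_add]
  gcongr

lemma pow_mul_pow_le_one {x y : ℝ} (hx : 0 ≤ x) (hy : 0 ≤ y) (hx' : x ≤ 1 / 2)
    (hy' : y ≤ 1 / 2) {k l : ℕ} (h : 1 ≤ k + l) :
    x ^ k * y ^ l ≤ 2 * (x + y) * (1 / 2) ^ (k + l) := by
  rcases k with _ | k
  · obtain ⟨l, rfl⟩ : ∃ l', l = l' + 1 := ⟨l - 1, by omega⟩
    have h1 := pow_mul_pow_le_half hx hy hx' hy' 0 l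
    calc x ^ 0 * y ^ (l + 1) = y * (x ^ 0 * y ^ l) := by ring
      _ ≤ (x + y) * (1 / 2) ^ (0 + l) := by gcongr; linarith
      _ = _ := by ring
  · have h1 := pow_mul_pow_le_half hx hy hx' hy' k l
    calc x ^ (k + 1) * y ^ l = x * (x ^ k * y ^ l) := by ring
      _ ≤ (x + y) * (1 / 2) ^ (k + l) := by gcongr; linarith
      _ = _ := by ring

lemma pow_mul_pow_le_mul {x y : ℝ} (hx : 0 ≤ x) (hy : 0 ≤ y) (hx' : x ≤ 1 / 2)
    (hy' : y ≤ 1 / 2) {k l : ℕ} (hk : 1 ≤ k) (h : 2 ≤ k + l) :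
    x ^ k * y ^ l ≤ 4 * (x * (x + y)) * (1 / 2) ^ (k + l) := by
  obtain ⟨k, rfl⟩ : ∃ k', k = k' + 1 := ⟨k - 1, by omega⟩
  have h1 := pow_mul_pow_le_one hx hy hx' hy' (k := k) (l := l) (by omega)
  calc x ^ (k + 1) * y ^ l = x * (x ^ k * y ^ l) := by ring
    _ ≤ x * (2 * (x + y) * (1 / 2) ^ (k + l)) := by gcongr
    _ = _ := by ring

lemma pow_mul_pow_le_sq {x y : ℝ} (hx : 0 ≤ x) (hy : 0 ≤ y) (hx' : x ≤ 1 / 2)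
    (hy' : y ≤ 1 / 2) {k l : ℕ} (h : 2 ≤ k + l) :
    x ^ k * y ^ l ≤ 4 * (x + y) ^ 2 * (1 / 2) ^ (k + l) := by
  rcases Nat.eq_zero_or_pos k with rfl | hk
  · have h1 := pow_mul_pow_le_mul hy hx hy' hx' (k := l) (l := 0) (by omega) (by omega)
    calc x ^ 0 * y ^ l = y ^ l * x ^ 0 := by ring
      _ ≤ 4 * (y * (y + x)) * (1 / 2) ^ (l + 0) := h1
      _ ≤ 4 * (x + y) ^ 2 * (1 / 2) ^ (0 + l) := by
        rw [add_zero, zero_add]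
        gcongr
        nlinarith
  · refine (pow_mul_pow_le_mul hx hy hx' hy' hk h).trans ?_
    gcongr
    nlinarith

lemma norm_le_of_hasSum_of_le {f : ℕ × ℕ → ℂ} {s : ℂ} (hf : HasSum f s) {M : ℝ}
    (h : ∀ n, ‖f n‖ ≤ M * (1 / 2) ^ (n.1 + n.2)) : ‖s‖ ≤ M * 4 := by
  rw [← hf.tsum_eq]
  exact tsum_of_norm_bounded (hasSum_half_pow.mul_left M) h

section Tail

variable {f : ℕ × ℕ → ℂ} {s : ℂ} {A x y : ℝ}

lemma norm_sum_le_of_zero (hf : HasSum f s) (hA : 0 ≤ A) (hx : 0 ≤ x) (hy : 0 ≤ y)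
    (hx' : x ≤ 1 / 2) (hy' : y ≤ 1 / 2) (h : ∀ n, ‖f n‖ ≤ A * (x ^ n.1 * y ^ n.2))
    (h0 : f (0, 0) = 0) : ‖s‖ ≤ 8 * A * (x + y) := by
  refine (norm_le_of_hasSum_of_le hf (M := A * (2 * (x + y))) ?_).trans (le_of_eq (by ring))
  rintro ⟨k, l⟩
  rcases Nat.eq_zero_or_pos (k + l) with h1 | h1
  · rw [show k = 0 by omega, show l = 0 by omega, h0, norm_zero]
    positivity
  · refine (h _).trans ?_
    rw [mul_assoc A]
    exact mul_le_mul_of_nonneg_left (pow_mul_pow_le_one hx hy hx' hy' h1) hA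

lemma norm_sum_sub_principal_le (hf : HasSum f s) (hA : 0 ≤ A) (hx : 0 ≤ x) (hy : 0 ≤ y)
    (hx' : x ≤ 1 / 2) (hy' : y ≤ 1 / 2) (h : ∀ n, ‖f n‖ ≤ A * (x ^ n.1 * y ^ n.2))
    (h0 : f (0, 0) = 0) : ‖s - f (1, 0) - f (0, 1)‖ ≤ 16 * A * (x + y) ^ 2 := by
  have hs := (hf.sub (hasSum_ite_eq ((1 : ℕ), (0 : ℕ)) (f (1, 0)))).sub
    (hasSum_ite_eq ((0 : ℕ), (1 : ℕ)) (f (0, 1)))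
  refine (norm_le_of_hasSum_of_le hs (M := A * (4 * (x + y) ^ 2)) ?_).trans
    (le_of_eq (by ring))
  rintro ⟨k, l⟩
  by_cases h2 : 2 ≤ k + l
  · have e1 : ((k, l) : ℕ × ℕ) ≠ (1, 0) := fun h => by simp at h; omega
    have e2 : ((k, l) : ℕ × ℕ) ≠ (0, 1) := fun h => by simp at h; omega
    rw [if_neg e1, if_neg e2, sub_zero, sub_zero]
    refine (h _).trans ?_
    rw [mul_assoc A]
    exact mul_le_mul_of_nonneg_left (pow_mul_pow_le_sq hx hy hx' hy' h2) hA
  · have hp : 0 ≤ A * (4 * (x + y) ^ 2) * (1 / 2) ^ (k + l) := by positivity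
    obtain ⟨rfl, rfl⟩ | ⟨rfl, rfl⟩ | ⟨rfl, rfl⟩ :
      (k = 0 ∧ l = 0) ∨ (k = 1 ∧ l = 0) ∨ (k = 0 ∧ l = 1) := by omega
    all_goals simpa [h0] using hp

lemma norm_sum_sub_first_le (hf : HasSum f s) (hA : 0 ≤ A) (hx : 0 ≤ x) (hy : 0 ≤ y)
    (hx' : x ≤ 1 / 2) (hy' : y ≤ 1 / 2) (h : ∀ n, ‖f n‖ ≤ A * (x ^ n.1 * y ^ n.2))
    (h0 : ∀ l, f (0, l) = 0) : ‖s - f (1, 0)‖ ≤ 16 * A * (x * (x + y)) := by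
  have hs := hf.sub (hasSum_ite_eq ((1 : ℕ), (0 : ℕ)) (f (1, 0)))
  refine (norm_le_of_hasSum_of_le hs (M := A * (4 * (x * (x + y)))) ?_).trans
    (le_of_eq (by ring))
  rintro ⟨k, l⟩
  have hp : 0 ≤ A * (4 * (x * (x + y))) * (1 / 2) ^ (k + l) := by positivity
  rcases Nat.eq_zero_or_pos k with rfl | hk
  · simpa [h0] using hp
  by_cases h2 : 2 ≤ k + l
  · have e1 : ((k, l) : ℕ × ℕ) ≠ (1, 0) := fun h => by simp at h; omega
    rw [if_neg e1, sub_zero]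
    refine (h _).trans ?_
    rw [mul_assoc A]
    exact mul_le_mul_of_nonneg_left (pow_mul_pow_le_mul hx hy hx' hy' hk h2) hA
  · obtain ⟨rfl, rfl⟩ : k = 1 ∧ l = 0 := by omega
    simpa using hp

end Tail

section Series

variable {lam mu : ℂ} {p : ℕ → ℕ → ℂ[X]}

lemma eventually_theta_le (R : ℝ) (d : ℕ) (c : ℂ) (h : 0 < lam.re) :
    ∀ᶠ u in atBot, theta R d c lam u ≤ 1 / 2 :=
  (tendsto_theta R d c h).eventually_le_const (by norm_num)

lemma GeomBounded.eventually_hasSum (hp : GeomBounded p) (hlam : 0 < lam.re) (hmu : 0 < mu.re)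
    (c₁ c₂ : ℂ) :
    ∀ᶠ u in atBot, HasSum (term lam mu c₁ c₂ p u) (series lam mu c₁ c₂ p u) := by
  obtain ⟨A, R, d, hA, hR, h⟩ := hp.norm_term_le lam mu
  filter_upwards [eventually_theta_le R d c₁ hlam, eventually_theta_le R d c₂ hmu] with u h1 h2
  refine (Summable.of_norm_bounded (hasSum_half_pow.summable.mul_left A) fun n => ?_).hasSum
  exact (h c₁ c₂ u n).trans (mul_le_mul_of_nonneg_left (pow_mul_pow_le_half
    (theta_nonneg hR _ _ _ _) (theta_nonneg hR _ _ _ _) h1 h2 _ _) hA)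

lemma GeomBounded.tendsto_series (hp : GeomBounded p) (hlam : 0 < lam.re) (hmu : 0 < mu.re)
    (c₁ c₂ : ℂ) (h0 : p 0 0 = 0) : Tendsto (series lam mu c₁ c₂ p) atBot (𝓝 0) := by
  obtain ⟨A, R, d, hA, hR, h⟩ := hp.norm_term_le lam mu
  have hlim := ((tendsto_theta R d c₁ hlam).add (tendsto_theta R d c₂ hmu)).const_mul (8 * A)
  rw [add_zero, mul_zero] at hlim
  refine squeeze_zero_norm' ?_ hlim
  filter_upwards [eventually_theta_le R d c₁ hlam, eventually_theta_le R d c₂ hmu,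
    hp.eventually_hasSum hlam hmu c₁ c₂] with u h1 h2 h3
  exact norm_sum_le_of_zero h3 hA (theta_nonneg hR _ _ _ _) (theta_nonneg hR _ _ _ _) h1 h2
    (h c₁ c₂ u) (by simp [term, h0])

lemma hasDerivAt_term (lam mu c₁ c₂ : ℂ) (p : ℕ → ℕ → ℂ[X]) (n : ℕ × ℕ) (u : ℝ) :
    HasDerivAt (fun u => term lam mu c₁ c₂ p u n) (term lam mu c₁ c₂ (xD lam mu p) u n) u := by
  unfold term
  set z := (n.1 : ℂ) * lam + n.2 * mu with hz
  have h1 : HasDerivAt (fun v : ℂ => Complex.exp (z * v)) (Complex.exp (z * u) * z) (u : ℂ) := by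
    simpa using ((hasDerivAt_id (u : ℂ)).const_mul z).cexp
  have h2 := ((h1.const_mul (c₁ ^ n.1 * c₂ ^ n.2)).mul
    ((p n.1 n.2).hasDerivAt (u : ℂ))).comp_ofReal
  refine h2.congr_deriv ?_
  simp only [xD, ← hz, eval_add, eval_mul, eval_C]
  ring

/-- Termwise differentiation near `u = -∞`. -/
lemma GeomBounded.exists_hasDerivAt_series (hp : GeomBounded p) (hlam : 0 < lam.re)
    (hmu : 0 < mu.re) (c₁ c₂ : ℂ) :
    ∃ U : ℝ, ∀ u < U, HasDerivAt (series lam mu c₁ c₂ p) (series lam mu c₁ c₂ (xD lam mu p) u) u := by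
  obtain ⟨A, R, d, hA, hR, h⟩ := (hp.apply_xD lam mu).norm_term_le lam mu
  have hev := ((eventually_theta_le R d c₁ hlam).and (eventually_theta_le R d c₂ hmu)).and
    (hp.eventually_hasSum hlam hmu c₁ c₂)
  obtain ⟨U, hU⟩ := eventually_atBot.1 hev
  refine ⟨U, fun u hu => ?_⟩
  refine hasDerivAt_tsum_of_isPreconnected (hasSum_half_pow.summable.mul_left A)
    isOpen_Iio isPreconnected_Iio (fun n y _ => hasDerivAt_term lam mu c₁ c₂ p n y)
    (fun n y hy => ?_) (show U - 1 ∈ Set.Iio U by simp) (hU (U - 1) (by linarith)).2.summable hu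
  obtain ⟨⟨h1, h2⟩, -⟩ := hU y (le_of_lt hy)
  exact (h c₁ c₂ y n).trans (mul_le_mul_of_nonneg_left (pow_mul_pow_le_half
    (theta_nonneg hR _ _ _ _) (theta_nonneg hR _ _ _ _) h1 h2 _ _) hA)

/-- The decompositions of a pair of natural numbers as a sum of two pairs. -/
@[reducible]
def natProdHasAntidiagonal : Finset.HasAntidiagonal (ℕ × ℕ) where
  antidiagonal n := (Finset.HasAntidiagonal.antidiagonal n.1 ×ˢ
    Finset.HasAntidiagonal.antidiagonal n.2).map (Equiv.prodProdProdComm ℕ ℕ ℕ ℕ).toEmbedding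
  mem_antidiagonal := by
    rintro ⟨k, l⟩ ⟨⟨a, b⟩, ⟨c, d⟩⟩
    simp [Equiv.prodProdProdComm]

lemma sum_natProd_antidiagonal (f : (ℕ × ℕ) × (ℕ × ℕ) → ℂ) (k l : ℕ) :
    ∑ n ∈ natProdHasAntidiagonal.antidiagonal (k, l), f n =
      ∑ i ∈ Finset.HasAntidiagonal.antidiagonal k, ∑ j ∈ Finset.HasAntidiagonal.antidiagonal l,
        f ((i.1, j.1), (i.2, j.2)) :=
  (Finset.sum_map _ _ _).trans (Finset.sum_product _ _ _)

lemma hasSum_term_conv {c₁ c₂ : ℂ} {a b : ℕ → ℕ → ℂ[X]} {u : ℝ} {s t : ℂ}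
    (ha : HasSum (term lam mu c₁ c₂ a u) s) (hb : HasSum (term lam mu c₁ c₂ b u) t) :
    HasSum (term lam mu c₁ c₂ (conv a b) u) (s * t) := by
  let _ := natProdHasAntidiagonal
  have hab := summable_mul_of_summable_norm ha.summable.norm hb.summable.norm
  have h1 := ha.summable.tsum_mul_tsum_eq_tsum_sum_antidiagonal hb.summable hab
  have h2 := summable_sum_mul_antidiagonal_of_summable_mul hab
  rw [ha.tsum_eq, hb.tsum_eq] at h1
  rw [h1]
  refine h2.hasSum.congr_fun ?_
  rintro ⟨k, l⟩
  refine Eq.trans ?_ (sum_natProd_antidiagonal _ k l).symm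
  simp only [term, conv, eval_finsetSum, eval_mul, Finset.mul_sum]
  refine Finset.sum_congr rfl fun i hi => Finset.sum_congr rfl fun j hj => ?_
  have hi' := Finset.HasAntidiagonal.mem_antidiagonal.1 hi
  have hj' := Finset.HasAntidiagonal.mem_antidiagonal.1 hj
  have hexp : Complex.exp (((k : ℂ) * lam + l * mu) * u)
      = Complex.exp (((i.1 : ℂ) * lam + j.1 * mu) * u)
        * Complex.exp (((i.2 : ℂ) * lam + j.2 * mu) * u) := by
    rw [← Complex.exp_add, ← hi', ← hj']
    congr 1
    push_cast
    ring
  rw [hexp, ← hi', ← hj', pow_add, pow_add]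
  ring

/-- The sum of a Lyapunov series solves the differential equation, written in `u = ln x`. -/
lemma IsLyapunovCoeffs.series_equation {m : ℂ} {e : ℂ[X]} {q : ℕ → ℕ → ℂ[X]}
    (hq : IsLyapunovCoeffs m lam mu e q) {c₁ c₂ : ℂ} {u : ℝ} {y₀ y₁ y₂ y₃ : ℂ}
    (h0 : HasSum (term lam mu c₁ c₂ q u) y₀)
    (h1 : HasSum (term lam mu c₁ c₂ (xD lam mu q) u) y₁)
    (h2 : HasSum (term lam mu c₁ c₂ (xD lam mu (xD lam mu q)) u) y₂)
    (h3 : HasSum (term lam mu c₁ c₂ (xD lam mu (xD lam mu (xD lam mu q))) u) y₃) :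
    (y₃ - 3 * y₂ + 2 * y₁) + 3 * (m - 1) / (m + 1) * (y₂ - y₁) + 6 * (m - 1) / (m + 1) * y₁
      + 6 * y₀ + 6 / (m + 1) * (m * ((y₂ - y₁) * y₀) - (m - 1) * (y₁ * y₁) - 2 * (y₁ * y₀)
        + (m + 1) * (y₀ * y₀)) = 0 := by
  have hD2 : HasSum (term lam mu c₁ c₂ (xD2 lam mu q) u) (y₂ - y₁) := by
    refine (h2.sub h1).congr_fun fun n => ?_
    simp only [term, xD2, eval_sub]
    ring
  have hD3 : HasSum (term lam mu c₁ c₂ (xD3 lam mu q) u) (y₃ - 3 * y₂ + 2 * y₁) := by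
    refine ((h3.sub (h2.mul_left 3)).add (h1.mul_left 2)).congr_fun fun n => ?_
    simp only [term, xD3, xD2, xD, eval_sub, eval_add, eval_mul, eval_C, derivative_sub,
      derivative_add, derivative_mul, derivative_C, eval_zero, eval_ofNat]
    ring
  have hsum := (((hD3.add (hD2.mul_left (3 * (m - 1) / (m + 1)))).add
    (h1.mul_left (6 * (m - 1) / (m + 1)))).add (h0.mul_left 6)).add
    (((((hasSum_term_conv hD2 h0).mul_left m).sub ((hasSum_term_conv h1 h1).mul_left (m - 1))).sub
      ((hasSum_term_conv h1 h0).mul_left 2)).add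
      ((hasSum_term_conv h0 h0).mul_left (m + 1)) |>.mul_left (6 / (m + 1)))
  refine hsum.unique ?_
  refine (hasSum_zero (α := ℂ) (β := ℕ × ℕ)).congr_fun fun n => ?_
  have hf := congrArg (Polynomial.eval (u : ℂ)) (hq.formal n.1 n.2)
  simp only [eval_add, eval_sub, eval_mul, eval_C, eval_ofNat, eval_zero] at hf
  simp only [term]
  linear_combination (c₁ ^ n.1 * c₂ ^ n.2 * Complex.exp (((n.1 : ℂ) * lam + n.2 * mu) * u)) * hf

end Series

/-! ### From the logarithmic variable back to `x` and `τ` -/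

section RealVariable

/-- Differentiation of `g(ln |τ - τp|) / (τ - τp)ᵏ`, on both sides of `τp`: the real logarithm
is even. -/
lemma hasDerivAt_log_div_pow {g : ℝ → ℝ} {g' τp τ : ℝ} (hτ : τ - τp ≠ 0)
    (hg : HasDerivAt g g' (Real.log (τ - τp))) (k : ℕ) :
    HasDerivAt (fun τ => g (Real.log (τ - τp)) / (τ - τp) ^ k)
      ((g' - k * g (Real.log (τ - τp))) / (τ - τp) ^ (k + 1)) τ := by
  have h1 : HasDerivAt (fun τ => τ - τp) 1 τ := (hasDerivAt_id τ).sub_const τp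
  have h2 : HasDerivAt (fun τ => g (Real.log (τ - τp))) (g' * (1 / (τ - τp))) τ :=
    hg.comp τ (h1.log hτ)
  have h3 := h2.div (h1.pow k) (pow_ne_zero k hτ)
  refine h3.congr_deriv ?_
  rcases k with _ | k
  · simp
    field_simp
  · simp only [Pi.pow_apply, Nat.add_sub_cancel]
    rw [div_eq_div_iff (by positivity) (by positivity)]
    field_simp
    ring

lemma contDiffOn_succ_of_hasDerivAt {f g : ℝ → ℝ} {s : Set ℝ} (hs : IsOpen s) {n : ℕ}
    (h : ∀ x ∈ s, HasDerivAt f (g x) x) (hg : ContDiffOn ℝ n g s) :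
    ContDiffOn ℝ (n + 1 : ℕ) f s := by
  push_cast
  rw [contDiffOn_succ_iff_deriv_of_isOpen hs]
  refine ⟨fun x hx => (h x hx).differentiableAt.differentiableWithinAt, by simp,
    hg.congr fun x hx => (h x hx).deriv⟩

/-- Identification of iterated derivatives from a chain of first-order derivatives on an open
set. -/
lemma iteratedDeriv_of_chain {Φ Φ₁ Φ₂ Φ₃ : ℝ → ℝ} {s : Set ℝ} (hs : IsOpen s)
    (h1 : ∀ x ∈ s, HasDerivAt Φ (Φ₁ x) x) (h2 : ∀ x ∈ s, HasDerivAt Φ₁ (Φ₂ x) x)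
    (h3 : ∀ x ∈ s, HasDerivAt Φ₂ (Φ₃ x) x) (hc : ContinuousOn Φ₃ s) :
    ContDiffOn ℝ 3 Φ s ∧ ∀ x ∈ s, deriv Φ x = Φ₁ x ∧ iteratedDeriv 2 Φ x = Φ₂ x ∧
      iteratedDeriv 3 Φ x = Φ₃ x := by
  have d1 : ∀ x ∈ s, deriv Φ x = Φ₁ x := fun x hx => (h1 x hx).deriv
  have d2 : ∀ x ∈ s, iteratedDeriv 2 Φ x = Φ₂ x := by
    intro x hx
    rw [iteratedDeriv_succ, iteratedDeriv_one]
    have : deriv Φ =ᶠ[𝓝 x] Φ₁ := eventually_of_mem (hs.mem_nhds hx) d1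
    rw [this.deriv_eq, (h2 x hx).deriv]
  refine ⟨?_, fun x hx => ⟨d1 x hx, d2 x hx, ?_⟩⟩
  · exact contDiffOn_succ_of_hasDerivAt hs h1 (contDiffOn_succ_of_hasDerivAt hs h2
      (contDiffOn_succ_of_hasDerivAt hs h3 (n := 0) (contDiffOn_zero.2 hc)))
  · rw [iteratedDeriv_succ]
    have : iteratedDeriv 2 Φ =ᶠ[𝓝 x] Φ₂ := eventually_of_mem (hs.mem_nhds hx) d2
    rw [this.deriv_eq, (h3 x hx).deriv]

/-- `f` is a solution on `(-∞, U)`, with its derivatives listed as `f 0, f 1, …`, of the equation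
for `Y` in the variable `u = ln x`. -/
structure LogSolution (m U : ℝ) (f : ℕ → ℝ → ℝ) : Prop where
  hasDeriv : ∀ j < 4, ∀ u < U, HasDerivAt (f j) (f (j + 1) u) u
  lim : ∀ j < 3, Tendsto (f j) atBot (𝓝 0)
  eqn : ∀ u < U, (f 3 u - 3 * f 2 u + 2 * f 1 u) + 3 * (m - 1) / (m + 1) * (f 2 u - f 1 u)
      + 6 * (m - 1) / (m + 1) * f 1 u + 6 * f 0 u
      + quadPart m (f 0 u) (f 1 u) (f 2 u - f 1 u) = 0

namespace LogSolution

variable {m U : ℝ} {f : ℕ → ℝ → ℝ}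

lemma log_lt {τ τp U : ℝ} (h : 0 < |τ - τp|) (h' : |τ - τp| < Real.exp U) :
    Real.log (τ - τp) < U := by
  rw [← Real.log_abs]
  exact (Real.log_lt_iff_lt_exp h).2 h'

theorem solvesSingularCP (hf : LogSolution m U f) :
    SolvesSingularCP m (Real.exp U) (fun x => f 0 (Real.log x)) := by
  have hlog : ∀ x ∈ Set.Ioo 0 (Real.exp U), Real.log x < U := fun x hx =>
    (Real.log_lt_iff_lt_exp hx.1).2 hx.2
  have key : ∀ (g : ℝ → ℝ) (g' x : ℝ) (k : ℕ), x ∈ Set.Ioo 0 (Real.exp U) →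
      HasDerivAt g g' (Real.log x) → HasDerivAt (fun x => g (Real.log x) / x ^ k)
        ((g' - k * g (Real.log x)) / x ^ (k + 1)) x := by
    intro g g' x k hx hg
    have := hasDerivAt_log_div_pow (τp := 0) (τ := x) (g := g) (g' := g')
      (by rw [sub_zero]; exact hx.1.ne') (by rwa [sub_zero]) k
    simpa only [sub_zero] using this
  have h1 : ∀ x ∈ Set.Ioo 0 (Real.exp U), HasDerivAt (fun x => f 0 (Real.log x))
      (f 1 (Real.log x) / x ^ 1) x := by
    intro x hx
    have := key (f 0) _ x 0 hx (hf.hasDeriv 0 (by norm_num) _ (hlog x hx))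
    simpa using this
  have h2 : ∀ x ∈ Set.Ioo 0 (Real.exp U), HasDerivAt (fun x => f 1 (Real.log x) / x ^ 1)
      ((f 2 (Real.log x) - f 1 (Real.log x)) / x ^ 2) x := by
    intro x hx
    have := key (f 1) _ x 1 hx (hf.hasDeriv 1 (by norm_num) _ (hlog x hx))
    simpa using this
  have h3 : ∀ x ∈ Set.Ioo 0 (Real.exp U),
      HasDerivAt (fun x => (f 2 (Real.log x) - f 1 (Real.log x)) / x ^ 2)
      ((f 3 (Real.log x) - 3 * f 2 (Real.log x) + 2 * f 1 (Real.log x)) / x ^ 3) x := by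
    intro x hx
    have := key (fun u => f 2 u - f 1 u) _ x 2 hx ((hf.hasDeriv 2 (by norm_num) _ (hlog x hx)).sub
      (hf.hasDeriv 1 (by norm_num) _ (hlog x hx)))
    refine this.congr_deriv ?_
    push_cast
    ring_nf
  have hc : ContinuousOn (fun x => (f 3 (Real.log x) - 3 * f 2 (Real.log x)
      + 2 * f 1 (Real.log x)) / x ^ 3) (Set.Ioo 0 (Real.exp U)) := by
    intro x hx
    exact (key (fun u => f 3 u - 3 * f 2 u + 2 * f 1 u) _ x 3 hx
      (((hf.hasDeriv 3 (by norm_num) _ (hlog x hx)).sub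
        ((hf.hasDeriv 2 (by norm_num) _ (hlog x hx)).const_mul 3)).add
        ((hf.hasDeriv 1 (by norm_num) _ (hlog x hx)).const_mul 2))).continuousAt.continuousWithinAt
  obtain ⟨hsm, hd⟩ := iteratedDeriv_of_chain isOpen_Ioo h1 h2 h3 hc
  have e1 : ∀ x ∈ Set.Ioo 0 (Real.exp U),
      x * deriv (fun x => f 0 (Real.log x)) x = f 1 (Real.log x) := by
    intro x hx
    have hx0 := hx.1.ne'
    rw [(hd x hx).1]
    field_simp
  have e2 : ∀ x ∈ Set.Ioo 0 (Real.exp U),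
      x ^ 2 * iteratedDeriv 2 (fun x => f 0 (Real.log x)) x
        = f 2 (Real.log x) - f 1 (Real.log x) := by
    intro x hx
    have hx0 := hx.1.ne'
    rw [(hd x hx).2.1]
    field_simp
  have e3 : ∀ x ∈ Set.Ioo 0 (Real.exp U),
      x ^ 3 * iteratedDeriv 3 (fun x => f 0 (Real.log x)) x
        = f 3 (Real.log x) - 3 * f 2 (Real.log x) + 2 * f 1 (Real.log x) := by
    intro x hx
    have hx0 := hx.1.ne'
    rw [(hd x hx).2.2]
    field_simp
  have hmem : ∀ᶠ x in 𝓝[>] (0 : ℝ), x ∈ Set.Ioo 0 (Real.exp U) :=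
    Ioo_mem_nhdsGT (Real.exp_pos U)
  have l := fun j hj => (hf.lim j hj).comp Real.tendsto_log_nhdsGT_zero
  refine ⟨hsm, fun x hx => ?_, l 0 (by norm_num), ?_, ?_⟩
  · rw [e3 x hx, e2 x hx, e1 x hx]
    exact hf.eqn _ (hlog x hx)
  · refine (l 1 (by norm_num)).congr' ?_
    filter_upwards [hmem] with x hx
    exact (e1 x hx).symm
  · have := (l 2 (by norm_num)).sub (l 1 (by norm_num))
    rw [sub_zero] at this
    refine this.congr' ?_
    filter_upwards [hmem] with x hx
    exact (e2 x hx).symm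

theorem isBlowUpSolution (hm : 0 < m) (hf : LogSolution m U f) (τp : ℝ) :
    IsBlowUpSolution m τp (Real.exp U)
      (fun τ => 6 * m / ((m + 1) * (τ - τp)) * (1 + f 0 (Real.log |τ - τp|))) := by
  have hm1 : m + 1 ≠ 0 := by positivity
  set A : ℝ := 6 * m / (m + 1) with hA
  set s : Set ℝ := {τ | 0 < |τ - τp| ∧ |τ - τp| < Real.exp U} with hs
  have hΦ : (fun τ => 6 * m / ((m + 1) * (τ - τp)) * (1 + f 0 (Real.log |τ - τp|)))
      = fun τ => A * ((1 + f 0 (Real.log (τ - τp))) / (τ - τp) ^ 1) := by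
    funext τ
    rw [Real.log_abs, hA, pow_one, div_mul_eq_div_div]
    ring
  have hopen : IsOpen s := by
    have hc : Continuous fun τ : ℝ => |τ - τp| := by fun_prop
    exact (isOpen_lt continuous_const hc).inter (isOpen_lt hc continuous_const)
  have hlog : ∀ τ ∈ s, Real.log (τ - τp) < U := fun τ hτ => log_lt hτ.1 hτ.2
  have hne : ∀ τ ∈ s, τ - τp ≠ 0 := fun τ hτ => abs_pos.1 hτ.1
  -- `Φ⁽ᵏ⁾ = A Gₖ(ln |τ - τp|) / (τ - τp)ᵏ⁺¹` with `G₀ = 1 + f` and `Gₖ₊₁ = Gₖ' - (k + 1) Gₖ`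
  have D : ∀ j < 4, ∀ τ ∈ s,
      HasDerivAt (f j) (f (j + 1) (Real.log (τ - τp))) (Real.log (τ - τp)) :=
    fun j hj τ hτ => hf.hasDeriv j hj _ (hlog τ hτ)
  have h1 : ∀ τ ∈ s, HasDerivAt
      (fun τ => A * ((1 + f 0 (Real.log (τ - τp))) / (τ - τp) ^ 1))
      (A * ((f 1 (Real.log (τ - τp)) - f 0 (Real.log (τ - τp)) - 1) / (τ - τp) ^ 2)) τ := by
    intro τ hτ
    refine ((hasDerivAt_log_div_pow (g := fun u => 1 + f 0 u) (hne τ hτ)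
      ((D 0 (by norm_num) τ hτ).const_add 1) 1).const_mul A).congr_deriv ?_
    push_cast
    ring_nf
  have h2 : ∀ τ ∈ s, HasDerivAt
      (fun τ => A * ((f 1 (Real.log (τ - τp)) - f 0 (Real.log (τ - τp)) - 1) / (τ - τp) ^ 2))
      (A * ((f 2 (Real.log (τ - τp)) - 3 * f 1 (Real.log (τ - τp))
        + 2 * f 0 (Real.log (τ - τp)) + 2) / (τ - τp) ^ 3)) τ := by
    intro τ hτ
    refine ((hasDerivAt_log_div_pow (g := fun u => f 1 u - f 0 u - 1) (hne τ hτ)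
      (((D 1 (by norm_num) τ hτ).sub (D 0 (by norm_num) τ hτ)).sub_const 1)
      2).const_mul A).congr_deriv ?_
    push_cast
    ring_nf
  have h3 : ∀ τ ∈ s, HasDerivAt
      (fun τ => A * ((f 2 (Real.log (τ - τp)) - 3 * f 1 (Real.log (τ - τp))
        + 2 * f 0 (Real.log (τ - τp)) + 2) / (τ - τp) ^ 3))
      (A * ((f 3 (Real.log (τ - τp)) - 6 * f 2 (Real.log (τ - τp))
        + 11 * f 1 (Real.log (τ - τp)) - 6 * f 0 (Real.log (τ - τp)) - 6) / (τ - τp) ^ 4)) τ := by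
    intro τ hτ
    refine ((hasDerivAt_log_div_pow (g := fun u => f 2 u - 3 * f 1 u + 2 * f 0 u + 2) (hne τ hτ)
      ((((D 2 (by norm_num) τ hτ).sub ((D 1 (by norm_num) τ hτ).const_mul 3)).add
        ((D 0 (by norm_num) τ hτ).const_mul 2)).add_const 2) 3).const_mul A).congr_deriv ?_
    push_cast
    ring_nf
  have hc : ContinuousOn (fun τ => A * ((f 3 (Real.log (τ - τp)) - 6 * f 2 (Real.log (τ - τp))
        + 11 * f 1 (Real.log (τ - τp)) - 6 * f 0 (Real.log (τ - τp)) - 6) / (τ - τp) ^ 4)) s := by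
    intro τ hτ
    exact ((hasDerivAt_log_div_pow (g := fun u => f 3 u - 6 * f 2 u + 11 * f 1 u - 6 * f 0 u - 6)
      (hne τ hτ) (((((D 3 (by norm_num) τ hτ).sub ((D 2 (by norm_num) τ hτ).const_mul 6)).add
        ((D 1 (by norm_num) τ hτ).const_mul 11)).sub
        ((D 0 (by norm_num) τ hτ).const_mul 6)).sub_const 6)
      4).const_mul A).continuousAt.continuousWithinAt
  obtain ⟨hsm, hd⟩ := iteratedDeriv_of_chain hopen h1 h2 h3 hc
  have hApos : 0 < A := by positivity
  have habs : Tendsto (fun τ : ℝ => |τ - τp|) (𝓝[≠] τp) (𝓝[>] 0) := by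
    refine tendsto_nhdsWithin_iff.2 ⟨?_, ?_⟩
    · have : Continuous fun τ : ℝ => |τ - τp| := by fun_prop
      have h := this.tendsto τp
      rw [sub_self, abs_zero] at h
      exact h.mono_left nhdsWithin_le_nhds
    · filter_upwards [self_mem_nhdsWithin] with τ hτ
      exact abs_pos.2 (sub_ne_zero.2 hτ)
  have hlim : Tendsto (fun τ : ℝ => A * (1 + f 0 (Real.log (τ - τp)))) (𝓝[≠] τp) (𝓝 A) := by
    have h := (((hf.lim 0 (by norm_num)).comp Real.tendsto_log_nhdsGT_zero).comp habs).const_add 1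
      |>.const_mul A
    rw [add_zero, mul_one] at h
    simpa only [Function.comp_def, Real.log_abs] using h
  have hsub : Tendsto (fun τ : ℝ => τ - τp) (𝓝 τp) (𝓝 0) := by
    have : Continuous fun τ : ℝ => τ - τp := by fun_prop
    have h := this.tendsto τp
    rwa [sub_self] at h
  rw [hΦ]
  refine ⟨hsm, fun τ h h' => ?_, ?_, ?_⟩
  · have hτ : τ ∈ s := ⟨h, h'⟩
    have ht := hne τ hτ
    obtain ⟨r1, r2, r3⟩ := hd τ hτ
    rw [r1, r2, r3]
    have he := hf.eqn _ (hlog τ hτ)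
    rw [quadPart] at he
    generalize f 0 (Real.log (τ - τp)) = y₀ at *
    generalize f 1 (Real.log (τ - τp)) = y₁ at *
    generalize f 2 (Real.log (τ - τp)) = y₂ at *
    generalize f 3 (Real.log (τ - τp)) = y₃ at *
    generalize τ - τp = t at *
    have h5 : (y₃ - 6 * y₂ + 11 * y₁ - 6 * y₀ - 6) + A * ((1 + y₀) * (y₂ - 3 * y₁ + 2 * y₀ + 2))
        - (m - 1) / m * A * (y₁ - y₀ - 1) ^ 2 = 0 := by
      rw [← he, hA]
      field_simp
      ring
    have h6 : A * ((y₃ - 6 * y₂ + 11 * y₁ - 6 * y₀ - 6) / t ^ 4) + A * ((1 + y₀) / t ^ 1)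
        * (A * ((y₂ - 3 * y₁ + 2 * y₀ + 2) / t ^ 3))
        - (m - 1) / m * (A * ((y₁ - y₀ - 1) / t ^ 2)) ^ 2
        = A / t ^ 4 * ((y₃ - 6 * y₂ + 11 * y₁ - 6 * y₀ - 6)
          + A * ((1 + y₀) * (y₂ - 3 * y₁ + 2 * y₀ + 2))
          - (m - 1) / m * A * (y₁ - y₀ - 1) ^ 2) := by
      field_simp
    rw [h6, h5, mul_zero]
  · have h1 : Tendsto (fun τ : ℝ => (τ - τp)⁻¹) (𝓝[>] τp) atTop := by
      refine tendsto_inv_nhdsGT_zero.comp (tendsto_nhdsWithin_iff.2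
        ⟨hsub.mono_left nhdsWithin_le_nhds, ?_⟩)
      filter_upwards [self_mem_nhdsWithin] with τ hτ
      exact sub_pos.2 (Set.mem_Ioi.1 hτ)
    have h2 := (hlim.mono_left (nhdsWithin_mono τp fun τ (hτ : τp < τ) => hτ.ne')).pos_mul_atTop
      hApos h1
    refine h2.congr fun τ => ?_
    rw [pow_one, mul_assoc, div_eq_mul_inv]
  · have h1 : Tendsto (fun τ : ℝ => (τ - τp)⁻¹) (𝓝[<] τp) atBot := by
      refine tendsto_inv_nhdsLT_zero.comp (tendsto_nhdsWithin_iff.2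
        ⟨hsub.mono_left nhdsWithin_le_nhds, ?_⟩)
      filter_upwards [self_mem_nhdsWithin] with τ hτ
      exact sub_neg.2 (Set.mem_Iio.1 hτ)
    have h2 := (hlim.mono_left (nhdsWithin_mono τp fun τ (hτ : τ < τp) => hτ.ne)).pos_mul_atBot
      hApos h1
    refine h2.congr fun τ => ?_
    rw [pow_one, mul_assoc, div_eq_mul_inv]

end LogSolution

end RealVariable

/-- If the sum of the Lyapunov series is real, its real part is a solution in the variable
`u = ln x`. -/
theorem IsLyapunovCoeffs.exists_logSolution {m : ℝ} {lam mu : ℂ} {e : ℂ[X]} {q : ℕ → ℕ → ℂ[X]}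
    (hq : IsLyapunovCoeffs (m : ℂ) lam mu e q) (hg : GeomBounded q) (hlam : 0 < lam.re)
    (hmu : 0 < mu.re) (c₁ c₂ : ℂ)
    (hreal : ∀ᶠ u in atBot, (series lam mu c₁ c₂ q u).im = 0) :
    ∃ U, LogSolution m U (fun j u => (series lam mu c₁ c₂ ((xD lam mu)^[j] q) u).re) := by
  set Q : ℕ → ℕ → ℕ → ℂ[X] := fun j => (xD lam mu)^[j] q with hQ
  have hQs : ∀ j, Q (j + 1) = xD lam mu (Q j) := fun j => Function.iterate_succ_apply' _ j q
  have hQg : ∀ j, GeomBounded (Q j) := by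
    intro j
    induction j with
    | zero => exact hg
    | succ j ih => rw [hQs]; exact ih.apply_xD lam mu
  have hQ0 : ∀ j, Q j 0 0 = 0 := by
    intro j
    induction j with
    | zero => exact hq.zero
    | succ j ih => rw [hQs]; exact xD_zero_zero lam mu ih
  choose V hV using fun j => (hQg j).exists_hasDerivAt_series hlam hmu c₁ c₂
  have hev := ((((hQg 0).eventually_hasSum hlam hmu c₁ c₂).and
    ((hQg 1).eventually_hasSum hlam hmu c₁ c₂)).and
    (((hQg 2).eventually_hasSum hlam hmu c₁ c₂).and
    ((hQg 3).eventually_hasSum hlam hmu c₁ c₂))).and hreal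
  obtain ⟨W, hW⟩ := eventually_atBot.1 hev
  set U : ℝ := min W (min (min (V 0) (V 1)) (min (V 2) (V 3))) with hU
  have hder : ∀ j < 4, ∀ u < U,
      HasDerivAt (series lam mu c₁ c₂ (Q j)) (series lam mu c₁ c₂ (Q (j + 1)) u) u := by
    intro j hj u hu
    simp only [hU, lt_min_iff] at hu
    obtain ⟨-, ⟨h0, h1⟩, ⟨h2, h3⟩⟩ := hu
    rw [hQs]
    refine hV j u ?_
    interval_cases j <;> assumption
  have hre : ∀ j < 4, ∀ u < U, HasDerivAt (fun u => (series lam mu c₁ c₂ (Q j) u).re)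
      (series lam mu c₁ c₂ (Q (j + 1)) u).re u := fun j hj u hu =>
    Complex.reCLM.hasFDerivAt.comp_hasDerivAt u (hder j hj u hu)
  have him : ∀ j < 4, ∀ u < U, (series lam mu c₁ c₂ (Q j) u).im = 0 := by
    intro j
    induction j with
    | zero =>
      intro _ u hu
      exact (hW u (hu.le.trans (min_le_left _ _))).2
    | succ j ih =>
      intro hj u hu
      have h1 : HasDerivAt (fun u => (series lam mu c₁ c₂ (Q j) u).im)
          (series lam mu c₁ c₂ (Q (j + 1)) u).im u :=
        Complex.imCLM.hasFDerivAt.comp_hasDerivAt u (hder j (by omega) u hu)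
      have h2 : (fun u => (series lam mu c₁ c₂ (Q j) u).im) =ᶠ[𝓝 u] fun _ => 0 := by
        filter_upwards [Iio_mem_nhds hu] with v hv
        exact ih (by omega) v hv
      exact h1.unique ((hasDerivAt_const u (0 : ℝ)).congr_of_eventuallyEq h2)
  refine ⟨U, hre, fun j hj => ?_, fun u hu => ?_⟩
  · have h1 := (hQg j).tendsto_series hlam hmu c₁ c₂ (hQ0 j)
    have h2 := (Complex.continuous_re.tendsto 0).comp h1
    rw [Complex.zero_re] at h2
    exact h2
  · obtain ⟨⟨⟨s0, s1⟩, s2, s3⟩, -⟩ := hW u (hu.le.trans (min_le_left _ _))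
    have hreal' : ∀ j < 4, ((series lam mu c₁ c₂ (Q j) u).re : ℂ) = series lam mu c₁ c₂ (Q j) u :=
      fun j hj => Complex.ext (by simp) (by simp [him j hj u hu])
    have key := hq.series_equation s0 s1 s2 s3
    change _ + quadPart m (series lam mu c₁ c₂ (Q 0) u).re (series lam mu c₁ c₂ (Q 1) u).re
      ((series lam mu c₁ c₂ (Q 2) u).re - (series lam mu c₁ c₂ (Q 1) u).re) = 0
    rw [← hreal' 0 (by norm_num), ← hreal' 1 (by norm_num), ← hreal' 2 (by norm_num),
      ← hreal' 3 (by norm_num)] at key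
    rw [quadPart]
    norm_cast at key
    rw [← key]
    ring

/-! ### Asymptotics of the sum -/

section Asymptotics

variable {lam mu : ℂ}

lemma exp_mul_pow_isLittleO {a : ℝ} (ha : 0 < a) (d : ℕ) :
    (fun u : ℝ => Real.exp (a * u) * (Real.exp (a * u) * (1 + |u|) ^ d))
      =o[atBot] fun u => Real.exp (a * u) := by
  have h := (isBigO_refl (fun u : ℝ => Real.exp (a * u)) atBot).mul_isLittleO
    ((isLittleO_one_iff ℝ).2 (tendsto_exp_mul_pow_atBot ha d))
  simpa only [mul_one] using h

lemma theta_le {R a : ℝ} (hR : 0 ≤ R) (ha : a ≤ lam.re) (d : ℕ) (c : ℂ) {u : ℝ} (hu : u ≤ 0) :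
    theta R d c lam u ≤ R * ‖c‖ * (Real.exp (a * u) * (1 + |u|) ^ d) := by
  unfold theta
  have : lam.re * u ≤ a * u := mul_le_mul_of_nonpos_right ha hu
  gcongr

/-- The sum of a Lyapunov series is given by its principal term up to an error negligible against
the larger of the two powers. -/
lemma IsLyapunovCoeffs.series_sub_principal_isLittleO {m : ℂ} {e : ℂ[X]} {q : ℕ → ℕ → ℂ[X]}
    (hq : IsLyapunovCoeffs m lam mu e q) (hg : GeomBounded q) {a : ℝ} (ha : 0 < a)
    (hlam : a ≤ lam.re) (hmu : a ≤ mu.re) (c₁ c₂ : ℂ) :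
    (fun u : ℝ => series lam mu c₁ c₂ q u -
      (c₁ * Complex.exp (lam * u) + c₂ * (Complex.exp (mu * u) * e.eval (u : ℂ))))
      =o[atBot] fun u => Real.exp (a * u) := by
  obtain ⟨A, R, d, hA, hR, h⟩ := hg.norm_term_le lam mu
  refine IsBigO.trans_isLittleO (g := fun u : ℝ =>
    Real.exp (a * u) * (Real.exp (a * u) * (1 + |u|) ^ (2 * d))) ?_ (exp_mul_pow_isLittleO ha _)
  have hl := ha.trans_le hlam
  have hm := ha.trans_le hmu
  refine IsBigO.of_bound (16 * A * (R * ‖c₁‖ + R * ‖c₂‖) ^ 2) ?_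
  filter_upwards [eventually_theta_le R d c₁ hl, eventually_theta_le R d c₂ hm,
    hg.eventually_hasSum hl hm c₁ c₂, eventually_le_atBot (0 : ℝ)] with u h1 h2 h3 hu
  have hb := norm_sum_sub_principal_le h3 hA (theta_nonneg hR _ _ _ _) (theta_nonneg hR _ _ _ _)
    h1 h2 (h c₁ c₂ u) (by simp [term, hq.zero])
  have e1 : series lam mu c₁ c₂ q u - term lam mu c₁ c₂ q u (1, 0)
      - term lam mu c₁ c₂ q u (0, 1) = series lam mu c₁ c₂ q u -
      (c₁ * Complex.exp (lam * u) + c₂ * (Complex.exp (mu * u) * e.eval (u : ℂ))) := by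
    simp [term, hq.principal₁, hq.principal₂]
    ring
  rw [e1] at hb
  refine hb.trans ?_
  have t1 := theta_le hR hlam d c₁ hu
  have t2 := theta_le hR hmu d c₂ hu
  have n1 := theta_nonneg hR d c₁ lam u
  have n2 := theta_nonneg hR d c₂ mu u
  rw [Real.norm_of_nonneg (by positivity)]
  calc 16 * A * (theta R d c₁ lam u + theta R d c₂ mu u) ^ 2
      ≤ 16 * A * (R * ‖c₁‖ * (Real.exp (a * u) * (1 + |u|) ^ d)
        + R * ‖c₂‖ * (Real.exp (a * u) * (1 + |u|) ^ d)) ^ 2 := by gcongr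
    _ = _ := by ring

/-- Dependence of the sum on the first parameter alone: the terms free of `c₁` cancel, so that the
error is negligible even against `x ^ lam` when that is the smaller of the two powers. -/
lemma IsLyapunovCoeffs.series_sub_series_isLittleO {m : ℂ} {e : ℂ[X]} {q : ℕ → ℕ → ℂ[X]}
    (hq : IsLyapunovCoeffs m lam mu e q) (hg : GeomBounded q)
    (hlam : 0 < lam.re) (hmu : 0 < mu.re) (c₁ c₁' c₂ : ℂ) :
    (fun u : ℝ => series lam mu c₁ c₂ q u - series lam mu c₁' c₂ q u
      - (c₁ - c₁') * Complex.exp (lam * u)) =o[atBot] fun u => Real.exp (lam.re * u) := by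
  obtain ⟨A, R, d, hA, hR, h⟩ := hg.norm_term_le lam mu
  set c : ℂ := ((‖c₁‖ + ‖c₁'‖ : ℝ) : ℂ) with hc
  have hcn : ‖c‖ = ‖c₁‖ + ‖c₁'‖ := by
    rw [hc, Complex.norm_real, Real.norm_of_nonneg (by positivity)]
  set g : ℝ → ℝ := fun u => theta R (d + d) c lam u + theta R (d + d) c₂ mu u with hgdef
  have hglim : Tendsto g atBot (𝓝 0) := by
    have := (tendsto_theta R (d + d) c hlam).add (tendsto_theta R (d + d) c₂ hmu)
    rwa [add_zero] at this
  have hlo : (fun u => Real.exp (lam.re * u) * g u)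
      =o[atBot] fun u => Real.exp (lam.re * u) := by
    have h := (isBigO_refl (fun u : ℝ => Real.exp (lam.re * u)) atBot).mul_isLittleO
      ((isLittleO_one_iff ℝ).2 hglim)
    simpa only [mul_one] using h
  refine IsBigO.trans_isLittleO ?_ hlo
  refine IsBigO.of_bound (16 * (2 * A) * (R * ‖c‖)) ?_
  filter_upwards [eventually_theta_le R d c hlam, eventually_theta_le R d c₂ hmu,
    hg.eventually_hasSum hlam hmu c₁ c₂, hg.eventually_hasSum hlam hmu c₁' c₂]
    with u h1 h2 h3 h3'
  have hle : ∀ b : ℂ, ‖b‖ ≤ ‖c‖ → theta R d b lam u ≤ theta R d c lam u := by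
    intro b hb
    unfold theta
    gcongr
  have l1 := hle c₁ (by rw [hcn]; linarith [norm_nonneg c₁'])
  have l2 := hle c₁' (by rw [hcn]; linarith [norm_nonneg c₁])
  have n0 := theta_nonneg hR d c₁ lam u
  have n0' := theta_nonneg hR d c₁' lam u
  have n1 := theta_nonneg hR d c lam u
  have n2 := theta_nonneg hR d c₂ mu u
  have hb := norm_sum_sub_first_le (h3.sub h3') (A := 2 * A) (by positivity) n1 n2 h1 h2
    (fun n => by
      refine (norm_sub_le _ _).trans ((add_le_add (h c₁ c₂ u n) (h c₁' c₂ u n)).trans ?_)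
      calc _ ≤ A * (theta R d c lam u ^ n.1 * theta R d c₂ mu u ^ n.2)
            + A * (theta R d c lam u ^ n.1 * theta R d c₂ mu u ^ n.2) := by gcongr
        _ = _ := by ring) (fun l => by simp [term])
  have e1 : series lam mu c₁ c₂ q u - series lam mu c₁' c₂ q u
      - (term lam mu c₁ c₂ q u (1, 0) - term lam mu c₁' c₂ q u (1, 0))
      = series lam mu c₁ c₂ q u - series lam mu c₁' c₂ q u
      - (c₁ - c₁') * Complex.exp (lam * u) := by
    simp [term, hq.principal₁]
    ring
  rw [e1] at hb
  refine hb.trans (le_of_eq ?_)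
  have hg0 : 0 ≤ g u := add_nonneg (theta_nonneg hR _ _ _ _) (theta_nonneg hR _ _ _ _)
  rw [Real.norm_of_nonneg (by positivity)]
  simp only [hgdef, theta, pow_add]
  ring

lemma series_zero_zero {q : ℕ → ℕ → ℂ[X]} (h : q 0 0 = 0) (u : ℝ) :
    series lam mu 0 0 q u = 0 := by
  have : ∀ n : ℕ × ℕ, term lam mu 0 0 q u n = 0 := by
    rintro ⟨k, l⟩
    rcases k with _ | k
    · rcases l with _ | l
      · simp [term, h]
      · simp [term]
    · simp [term]
  simp only [series, this, tsum_zero]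

lemma re_isLittleO {f : ℝ → ℂ} {g : ℝ → ℝ} (h : f =o[atBot] g) :
    (fun u => (f u).re) =o[atBot] g :=
  IsBigO.trans_isLittleO (g := f) (IsBigO.of_bound 1 (Eventually.of_forall fun u => by
    simpa using Complex.abs_re_le_norm (f u))) h

/-- A function that agrees near `+0` after the substitution `x = eᵘ` agrees near `u = -∞`. -/
lemma eventuallyEq_atBot_of_nhdsGT {f g : ℝ → ℝ}
    (h : (fun x => f (Real.log x)) =ᶠ[𝓝[>] 0] fun x => g (Real.log x)) : f =ᶠ[atBot] g := by
  filter_upwards [Real.tendsto_exp_atBot_nhdsGT.eventually h] with u hu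
  simpa only [Real.log_exp] using hu

lemma exp_mul_log_eventuallyEq (a : ℝ) :
    (fun x => Real.exp (a * Real.log x)) =ᶠ[𝓝[>] 0] fun x => x ^ a := by
  filter_upwards [self_mem_nhdsWithin] with x hx
  rw [Real.rpow_def_of_pos hx, mul_comm]

end Asymptotics

/-! ### Numerical facts about the exponents -/

lemma one_half_lt_mCrit : 1 / 2 < mCrit := by
  have h : (57 / 24 : ℝ) < Real.sqrt 6 := Real.lt_sqrt_of_sq_lt (by norm_num)
  unfold mCrit
  linarith

lemma kappa_eq (m : ℝ) : kappa m = 23 * (m - mCrit) * (m + 34 / 23 + mCrit) := by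
  have h : Real.sqrt 6 ^ 2 = 6 := Real.sq_sqrt (by norm_num)
  unfold kappa mCrit
  linear_combination (144 / 23) * h

lemma kappa_pos {m : ℝ} (h : mCrit < m) : 0 < kappa m := by
  have := one_half_lt_mCrit
  rw [kappa_eq]
  exact mul_pos (mul_pos (by norm_num) (by linarith)) (by linarith)

lemma kappa_neg {m : ℝ} (hm : 0 < m) (h : m < mCrit) : kappa m < 0 := by
  have := one_half_lt_mCrit
  rw [kappa_eq]
  exact mul_neg_of_neg_of_pos (mul_neg_of_pos_of_neg (by norm_num) (by linarith)) (by linarith)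

lemma alpha_pos {m : ℝ} (hm : 0 < m) : 0 < alpha m := by
  unfold alpha
  positivity

lemma beta_pos {m : ℝ} (hm : 0 < m) (h : mCrit < m) : 0 < beta m := by
  have := Real.sqrt_pos.2 (kappa_pos h)
  unfold beta
  positivity

lemma alpha_sq_add_beta_sq {m : ℝ} (hm : 0 < m) (h : mCrit ≤ m) :
    alpha m ^ 2 + beta m ^ 2 = 6 := by
  have hk : 0 ≤ kappa m := by
    rcases h.lt_or_eq with h | h
    · exact (kappa_pos h).le
    · rw [kappa_eq, h]; simp
  have hs := Real.sq_sqrt hk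
  unfold alpha beta
  rw [div_pow, div_pow, hs, kappa]
  field_simp
  ring

lemma alpha_sq_of_eq {m : ℝ} (hm : 0 < m) (h : m = mCrit) : alpha m * alpha m = 6 := by
  have h1 := alpha_sq_add_beta_sq hm h.ge
  have h2 : beta m = 0 := by
    unfold beta
    rw [kappa_eq, h]
    simp
  rw [h2] at h1
  linarith

lemma two_alpha {m : ℝ} (hm : 0 < m) : (m + 1) * (alpha m + alpha m) = m + 7 := by
  unfold alpha
  field_simp
  ring

lemma lam_add {m : ℝ} (hm : 0 < m) : (m + 1) * (lam₁ m + lam₂ m) = m + 7 := by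
  unfold lam₁ lam₂
  field_simp
  ring

lemma lam_mul {m : ℝ} (hm : 0 < m) (h : m < mCrit) : lam₁ m * lam₂ m = 6 := by
  have hs := Real.sq_sqrt (neg_pos.2 (kappa_neg hm h)).le
  unfold lam₁ lam₂
  rw [div_mul_div_comm, div_eq_iff (by positivity)]
  rw [show (m + 7 + √(-kappa m)) * (m + 7 - √(-kappa m)) = (m + 7) ^ 2 - √(-kappa m) ^ 2 by ring,
    hs, kappa]
  ring

lemma lam₂_lt_lam₁ {m : ℝ} (hm : 0 < m) (h : m < mCrit) : lam₂ m < lam₁ m := by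
  have := Real.sqrt_pos.2 (neg_pos.2 (kappa_neg hm h))
  unfold lam₁ lam₂
  gcongr
  linarith

lemma lam₂_pos {m : ℝ} (hm : 0 < m) (h : m < mCrit) : 0 < lam₂ m := by
  have h1 := lam_mul hm h
  have h2 : 0 < lam₁ m := by
    have := Real.sqrt_nonneg (-kappa m)
    unfold lam₁
    positivity
  by_contra h3
  have := mul_nonpos_of_nonneg_of_nonpos h2.le (not_lt.1 h3)
  linarith

lemma Exponents.map {𝕜 𝕂 : Type*} [Field 𝕜] [Field 𝕂] (σ : 𝕜 →+* 𝕂) {m lam mu : 𝕜}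
    (h : Exponents m lam mu) : Exponents (σ m) (σ lam) (σ mu) where
  ne_zero := by
    have := (map_ne_zero σ).2 h.ne_zero
    rwa [map_add, map_one] at this
  sum := by
    have h7 : σ 7 = 7 := map_ofNat σ 7
    have := congrArg σ h.sum
    rwa [map_mul, map_add, map_add, map_add, map_one, h7] at this
  prod := by
    have h6 : σ 6 = 6 := map_ofNat σ 6
    have := congrArg σ h.prod
    rwa [map_mul, h6] at this
  ne_neg_one := fun k l hkl => by
    have := (map_ne_zero σ).2 (h.ne_neg_one k l hkl)
    simpa only [map_add, map_mul, map_natCast, map_one] using this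
  ne_mu := fun k l hkl => by
    have := (map_ne_zero σ).2 (h.ne_mu k l hkl)
    simpa only [map_add, map_sub, map_mul, map_natCast] using this
  resonance := fun k l hkl h0 => by
    refine h.resonance k l hkl ((map_eq_zero σ).1 ?_)
    simpa only [map_add, map_sub, map_mul, map_natCast] using h0

lemma exponents_real {m lam mu : ℝ} (hm : 0 < m) (hs : (m + 1) * (lam + mu) = m + 7)
    (hp : lam * mu = 6) (hmu : 0 < mu) (hle : mu ≤ lam) : Exponents m lam mu := by
  have hlam := hmu.trans_le hle
  have key : ∀ k l : ℕ, 2 ≤ k + l → 2 * mu ≤ (k : ℝ) * lam + l * mu := by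
    intro k l h
    have h1 : (2 : ℝ) ≤ k + l := by exact_mod_cast h
    have h2 : (k : ℝ) * mu ≤ k * lam := by gcongr
    nlinarith
  refine ⟨by positivity, hs, hp, fun k l _ => by positivity, fun k l h => ?_, fun k l h h0 => ?_⟩
  · have := key k l h
    exact ne_of_gt (by linarith)
  · by_contra hk
    have hk1 : (1 : ℝ) ≤ k := by exact_mod_cast Nat.one_le_iff_ne_zero.2 hk
    have h1 : (2 : ℝ) ≤ k + l := by exact_mod_cast h
    have hl : (0 : ℝ) ≤ l := by positivity
    have h2 : ((k : ℝ) - 1) * mu ≤ (k - 1) * lam := mul_le_mul_of_nonneg_left hle (by linarith)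
    nlinarith

lemma exponents_complex {m : ℝ} (hm : 0 < m) (h : mCrit < m) :
    Exponents (m : ℂ) (alpha m + beta m * Complex.I) (alpha m - beta m * Complex.I) := by
  have ha := alpha_pos hm
  have hre : ∀ k l : ℕ, ((k : ℂ) * (alpha m + beta m * Complex.I)
      + l * (alpha m - beta m * Complex.I)).re = (k + l) * alpha m := by
    intro k l
    simp
    ring
  have him : ∀ k l : ℕ, 2 ≤ k + l → alpha m < ((k : ℝ) + l) * alpha m := by
    intro k l h
    have h1 : (2 : ℝ) ≤ k + l := by exact_mod_cast h
    nlinarith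
  refine ⟨?_, ?_, ?_, fun k l h h0 => ?_, fun k l h h0 => ?_, fun k l h h0 => ?_⟩
  · exact_mod_cast (by positivity : m + 1 ≠ 0)
  · have := congrArg (fun x : ℝ => (x : ℂ)) (two_alpha hm)
    push_cast at this
    linear_combination this
  · have := congrArg (fun x : ℝ => (x : ℂ)) (alpha_sq_add_beta_sq hm h.le)
    push_cast at this
    linear_combination this - (beta m : ℂ) ^ 2 * Complex.I_sq
  all_goals
    have h1 := congrArg Complex.re h0
    simp only [Complex.add_re (_ + _), Complex.sub_re (_ + _), hre] at h1
    have h2 := him k l h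
    simp at h1
    linarith

/-! ### Real exponents -/

section RealExponents

variable {m lam mu : ℝ} {e : ℝ[X]} {q : ℕ → ℕ → ℝ[X]}

/-- The sum of the Lyapunov series with real exponents and real coefficients, in the variable
`u = ln x`. -/
def realSeries (lam mu : ℝ) (q : ℕ → ℕ → ℝ[X]) (C₁ C₂ u : ℝ) : ℝ :=
  (series lam mu C₁ C₂ (fun k l => (q k l).map Complex.ofRealHom) u).re

lemma term_ofReal (lam mu C₁ C₂ : ℝ) (q : ℕ → ℕ → ℝ[X]) (u : ℝ) (n : ℕ × ℕ) :
    term lam mu C₁ C₂ (fun k l => (q k l).map Complex.ofRealHom) u n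
      = ((C₁ ^ n.1 * C₂ ^ n.2 * Real.exp ((n.1 * lam + n.2 * mu) * u) * (q n.1 n.2).eval u : ℝ)
        : ℂ) := by
  have h : ((q n.1 n.2).map Complex.ofRealHom).eval (u : ℂ) = (((q n.1 n.2).eval u : ℝ) : ℂ) := by
    have := eval_map_apply Complex.ofRealHom (p := q n.1 n.2) u
    simpa using this
  simp only [term, h]
  push_cast
  rfl

namespace IsLyapunovCoeffs

lemma ofReal (hq : IsLyapunovCoeffs m lam mu e q) :
    IsLyapunovCoeffs (m : ℂ) lam mu (e.map Complex.ofRealHom)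
      (fun k l => (q k l).map Complex.ofRealHom) := hq.map Complex.ofRealHom

lemma geomBounded_ofReal (hE : Exponents m lam mu) (hq : IsLyapunovCoeffs m lam mu e q)
    (hlam : 0 < lam) (hmu : 0 < mu) :
    GeomBounded (fun k l => (q k l).map Complex.ofRealHom) :=
  hq.ofReal.geomBounded (hE.map Complex.ofRealHom) (lt_min hlam hmu)
    (by simp) (by simp)

lemma eventually_hasSum_realSeries (hE : Exponents m lam mu)
    (hq : IsLyapunovCoeffs m lam mu e q) (hlam : 0 < lam) (hmu : 0 < mu) (C₁ C₂ : ℝ) :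
    ∀ᶠ u : ℝ in atBot, HasSum (fun n : ℕ × ℕ => C₁ ^ n.1 * C₂ ^ n.2 *
      Real.exp ((n.1 * lam + n.2 * mu) * u) * (q n.1 n.2).eval u) (realSeries lam mu q C₁ C₂ u) ∧
      (series lam mu C₁ C₂ (fun k l => (q k l).map Complex.ofRealHom) u).im = 0 := by
  filter_upwards [(geomBounded_ofReal hE hq hlam hmu).eventually_hasSum
    (lam := lam) (mu := mu) hlam hmu C₁ C₂] with u hu
  have hterm := fun n => term_ofReal lam mu C₁ C₂ q u n
  have hre := Complex.hasSum_re hu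
  have him := Complex.hasSum_im hu
  simp only [hterm, Complex.ofReal_re, Complex.ofReal_im] at hre him
  exact ⟨hre, him.unique hasSum_zero⟩

lemma eventually_hasSum_rpow (hE : Exponents m lam mu) (hq : IsLyapunovCoeffs m lam mu e q)
    (hlam : 0 < lam) (hmu : 0 < mu) (C₁ C₂ : ℝ) :
    ∀ᶠ x : ℝ in 𝓝[>] 0, HasSum (fun n : ℕ × ℕ => C₁ ^ n.1 * C₂ ^ n.2 *
      x ^ ((n.1 : ℝ) * lam + (n.2 : ℝ) * mu) * (q n.1 n.2).eval (Real.log x))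
      (realSeries lam mu q C₁ C₂ (Real.log x)) := by
  filter_upwards [Real.tendsto_log_nhdsGT_zero.eventually
    (eventually_hasSum_realSeries hE hq hlam hmu C₁ C₂), self_mem_nhdsWithin] with x hx hx0
  refine hx.1.congr_fun fun n => ?_
  rw [Real.rpow_def_of_pos hx0, mul_comm (Real.log x)]

theorem realSeries_solves (hm : 0 < m) (hE : Exponents m lam mu)
    (hq : IsLyapunovCoeffs m lam mu e q) (hlam : 0 < lam) (hmu : 0 < mu) (C₁ C₂ : ℝ) :
    ∃ δ : ℝ, 0 < δ ∧ SolvesSingularCP m δ (fun x => realSeries lam mu q C₁ C₂ (Real.log x)) ∧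
      ∀ τp : ℝ, IsBlowUpSolution m τp δ (fun τ => 6 * m / ((m + 1) * (τ - τp)) *
        (1 + realSeries lam mu q C₁ C₂ (Real.log |τ - τp|))) := by
  obtain ⟨U, hU⟩ := hq.ofReal.exists_logSolution (geomBounded_ofReal hE hq hlam hmu)
    (lam := lam) (mu := mu) hlam hmu C₁ C₂
    ((eventually_hasSum_realSeries hE hq hlam hmu C₁ C₂).mono fun u hu => hu.2)
  exact ⟨Real.exp U, Real.exp_pos U, hU.solvesSingularCP, hU.isBlowUpSolution hm⟩

lemma realSeries_sub_principal_isLittleO (hE : Exponents m lam mu)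
    (hq : IsLyapunovCoeffs m lam mu e q) (hmu : 0 < mu) (hle : mu ≤ lam) (C₁ C₂ : ℝ) :
    (fun u : ℝ => realSeries lam mu q C₁ C₂ u -
      (C₁ * Real.exp (lam * u) + C₂ * (Real.exp (mu * u) * e.eval u)))
      =o[atBot] fun u => Real.exp (mu * u) := by
  have hlam := hmu.trans_le hle
  have h := re_isLittleO (hq.ofReal.series_sub_principal_isLittleO
    (geomBounded_ofReal hE hq hlam hmu) (lam := lam) (mu := mu) hmu (by simpa using hle)
    (by simp) C₁ C₂)
  refine h.congr_left fun u => ?_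
  have he : (e.map Complex.ofRealHom).eval (u : ℂ) = ((e.eval u : ℝ) : ℂ) := by
    have := eval_map_apply Complex.ofRealHom (p := e) u
    simpa using this
  rw [he, Complex.sub_re, realSeries]
  congr 1
  norm_cast

lemma realSeries_sub_realSeries_isLittleO (hE : Exponents m lam mu)
    (hq : IsLyapunovCoeffs m lam mu e q) (hlam : 0 < lam) (hmu : 0 < mu) (C₁ C₁' C₂ : ℝ) :
    (fun u : ℝ => realSeries lam mu q C₁ C₂ u - realSeries lam mu q C₁' C₂ u
      - (C₁ - C₁') * Real.exp (lam * u)) =o[atBot] fun u => Real.exp (lam * u) := by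
  have h := re_isLittleO (hq.ofReal.series_sub_series_isLittleO
    (geomBounded_ofReal hE hq hlam hmu) (lam := lam) (mu := mu) hlam hmu C₁ C₁' C₂)
  refine h.congr_left fun u => ?_
  rw [Complex.sub_re, Complex.sub_re, realSeries, realSeries]
  congr 1
  norm_cast

lemma realSeries_zero (hq : IsLyapunovCoeffs m lam mu e q) (u : ℝ) :
    realSeries lam mu q 0 0 u = 0 := by
  have := series_zero_zero (lam := lam) (mu := mu)
    (q := fun k l => (q k l).map Complex.ofRealHom) hq.ofReal.zero u
  simp [realSeries, this]

end IsLyapunovCoeffs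

end RealExponents

/-! ### Comparison of principal terms -/

section Comparison

lemma isLittleO_principal_sub {f f' v v' g : ℝ → ℝ} (h : (fun u => f u - v u) =o[atBot] g)
    (h' : (fun u => f' u - v' u) =o[atBot] g) (hff : f =ᶠ[atBot] f') :
    (fun u => v u - v' u) =o[atBot] g := by
  refine (h'.sub h).congr' ?_ EventuallyEq.rfl
  filter_upwards [hff] with u hu
  rw [hu]
  ring

lemma tendsto_zero_of_exp_mul_isLittleO {a : ℝ} {w : ℝ → ℝ}
    (h : (fun u => Real.exp (a * u) * w u) =o[atBot] fun u => Real.exp (a * u)) :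
    Tendsto w atBot (𝓝 0) := by
  refine h.tendsto_div_nhds_zero.congr fun u => ?_
  rw [mul_div_cancel_left₀ _ (Real.exp_pos _).ne']

lemma eq_zero_of_tendsto_affine {D₁ D₂ : ℝ}
    (h : Tendsto (fun u : ℝ => D₁ + D₂ * u) atBot (𝓝 0)) : D₁ = 0 ∧ D₂ = 0 := by
  have hinv : Tendsto (fun u : ℝ => u⁻¹) atBot (𝓝 0) := tendsto_inv_atBot_zero
  have h1 := (h.mul hinv).sub (hinv.const_mul D₁)
  have h2 : Tendsto (fun _ : ℝ => D₂) atBot (𝓝 (0 * 0 - D₁ * 0)) := by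
    refine h1.congr' ?_
    filter_upwards [eventually_lt_atBot (0 : ℝ)] with u hu
    field_simp [hu.ne]
    ring
  have h3 : D₂ = 0 := by simpa using tendsto_nhds_unique tendsto_const_nhds h2
  refine ⟨?_, h3⟩
  rw [h3] at h
  simp only [zero_mul, add_zero] at h
  exact tendsto_nhds_unique tendsto_const_nhds h

lemma eq_zero_of_tendsto_trig {b D₁ D₂ : ℝ} (hb : 0 < b)
    (h : Tendsto (fun u : ℝ => D₁ * Real.cos (b * u) + D₂ * Real.sin (b * u)) atBot (𝓝 0)) :
    D₁ = 0 ∧ D₂ = 0 := by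
  have hseq : ∀ θ : ℝ, Tendsto (fun n : ℕ => (θ - n * (2 * Real.pi)) / b) atTop atBot := by
    intro θ
    refine Tendsto.atBot_div_const hb ?_
    refine tendsto_atBot_add_const_left _ θ (tendsto_neg_atTop_atBot.comp
      (tendsto_natCast_atTop_atTop.atTop_mul_const Real.two_pi_pos))
  have key : ∀ θ : ℝ, D₁ * Real.cos θ + D₂ * Real.sin θ = 0 := by
    intro θ
    have h1 := h.comp (hseq θ)
    refine tendsto_nhds_unique tendsto_const_nhds (h1.congr fun n => ?_)
    simp only [Function.comp_apply]
    rw [mul_div_cancel₀ _ hb.ne', Real.cos_sub_nat_mul_two_pi, Real.sin_sub_nat_mul_two_pi]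
  exact ⟨by simpa using key 0, by simpa using key (Real.pi / 2)⟩

lemma tendsto_exp_sub {lam mu : ℝ} (hlt : mu < lam) (C₁ C₂ : ℝ) :
    Tendsto (fun u : ℝ => C₁ * Real.exp ((lam - mu) * u) + C₂) atBot (𝓝 C₂) := by
  have h1 : Tendsto (fun u : ℝ => Real.exp ((lam - mu) * u)) atBot (𝓝 0) :=
    Real.tendsto_exp_atBot.comp (tendsto_id.const_mul_atBot (sub_pos.2 hlt))
  simpa using (h1.const_mul C₁).add_const C₂

lemma exp_combination (lam mu C₁ C₂ u : ℝ) :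
    C₁ * Real.exp (lam * u) + C₂ * Real.exp (mu * u)
    = Real.exp (mu * u) * (C₁ * Real.exp ((lam - mu) * u) + C₂) := by
  have : Real.exp (lam * u) = Real.exp (mu * u) * Real.exp ((lam - mu) * u) := by
    rw [← Real.exp_add]
    ring_nf
  rw [this]
  ring

/-- Asymptotics in `u = ln x` transported to `x → +0`. -/
lemma isEquivalent_log {f v : ℝ → ℝ} {w : ℝ → ℝ} (h : (fun u => f u - v u) =o[atBot] v)
    (hw : (fun x => v (Real.log x)) =ᶠ[𝓝[>] 0] w) :
    (fun x => f (Real.log x)) ~[𝓝[>] 0] w :=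
  IsEquivalent.congr_right (h.comp_tendsto Real.tendsto_log_nhdsGT_zero) hw

end Comparison

/-! ### The double exponent -/

namespace IsLyapunovCoeffs

variable {m lam mu : ℝ}

lemma double_isLittleO {q : ℕ → ℕ → ℝ[X]} (hE : Exponents m lam lam)
    (hq : IsLyapunovCoeffs m lam lam X q) (hlam : 0 < lam) (C₁ C₂ : ℝ) :
    (fun u : ℝ => realSeries lam lam q C₁ C₂ u - Real.exp (lam * u) * (C₁ + C₂ * u))
      =o[atBot] fun u => Real.exp (lam * u) := by
  refine (realSeries_sub_principal_isLittleO hE hq hlam le_rfl C₁ C₂).congr_left fun u => ?_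
  rw [eval_X]
  ring

lemma double_isEquivalent {q : ℕ → ℕ → ℝ[X]} (hE : Exponents m lam lam)
    (hq : IsLyapunovCoeffs m lam lam X q) (hlam : 0 < lam) (C₁ C₂ : ℝ) :
    (fun x => realSeries lam lam q C₁ C₂ (Real.log x)) ~[𝓝[>] 0]
      (fun x => x ^ lam * (C₁ + C₂ * Real.log x)) := by
  refine isEquivalent_log (v := fun u => Real.exp (lam * u) * (C₁ + C₂ * u)) ?_ ?_
  · by_cases h0 : C₁ = 0 ∧ C₂ = 0
    · obtain ⟨rfl, rfl⟩ := h0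
      simp [realSeries_zero hq]
    refine (double_isLittleO hE hq hlam C₁ C₂).trans_isBigO ?_
    have h1 : (fun _ : ℝ => (1 : ℝ)) =O[atBot] fun u : ℝ => C₁ + C₂ * u := by
      rcases eq_or_ne C₂ 0 with rfl | h2
      · have : C₁ ≠ 0 := fun h => h0 ⟨h, rfl⟩
        simpa using isBigO_const_const (1 : ℝ) this (atBot : Filter ℝ)
      · have h3 : Tendsto (fun u : ℝ => ‖C₂ * u + C₁‖) atBot atTop := by
          rcases h2.lt_or_gt with h | h
          · have h3 : Tendsto (fun u : ℝ => C₂ * u) atBot atTop :=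
              tendsto_id.const_mul_atBot_of_neg h
            exact tendsto_abs_atTop_atTop.comp (tendsto_atTop_add_const_right _ _ h3)
          · have h3 : Tendsto (fun u : ℝ => C₂ * u) atBot atBot := tendsto_id.const_mul_atBot h
            exact tendsto_abs_atBot_atTop.comp (tendsto_atBot_add_const_right _ _ h3)
        refine IsBigO.of_bound 1 ?_
        filter_upwards [h3.eventually_ge_atTop 1] with u hu
        rw [norm_one, one_mul, add_comm]
        exact hu
    simpa only [mul_one] using
      (isBigO_refl (fun u : ℝ => Real.exp (lam * u)) atBot).mul h1
  · filter_upwards [exp_mul_log_eventuallyEq lam] with x hx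
    rw [hx]

lemma double_injective {q : ℕ → ℕ → ℝ[X]} (hE : Exponents m lam lam)
    (hq : IsLyapunovCoeffs m lam lam X q) (hlam : 0 < lam) {C₁ C₂ C₁' C₂' : ℝ}
    (h : realSeries lam lam q C₁ C₂ =ᶠ[atBot] realSeries lam lam q C₁' C₂') :
    C₁ = C₁' ∧ C₂ = C₂' := by
  have h1 := isLittleO_principal_sub (double_isLittleO hE hq hlam C₁ C₂)
    (double_isLittleO hE hq hlam C₁' C₂') h
  have h2 : Tendsto (fun u : ℝ => (C₁ - C₁') + (C₂ - C₂') * u) atBot (𝓝 0) :=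
    tendsto_zero_of_exp_mul_isLittleO (a := lam) (h1.congr_left fun u => by ring)
  obtain ⟨e1, e2⟩ := eq_zero_of_tendsto_affine h2
  exact ⟨sub_eq_zero.1 e1, sub_eq_zero.1 e2⟩

/-! ### Two real exponents -/

lemma distinct_isLittleO {q : ℕ → ℕ → ℝ[X]} (hE : Exponents m lam mu)
    (hq : IsLyapunovCoeffs m lam mu 1 q) (hmu : 0 < mu) (hlt : mu < lam) (C₁ C₂ : ℝ) :
    (fun u : ℝ => realSeries lam mu q C₁ C₂ u
      - (C₁ * Real.exp (lam * u) + C₂ * Real.exp (mu * u)))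
      =o[atBot] fun u => Real.exp (mu * u) := by
  refine (realSeries_sub_principal_isLittleO hE hq hmu hlt.le C₁ C₂).congr_left fun u => ?_
  rw [eval_one, mul_one]

lemma distinct_isEquivalent {q : ℕ → ℕ → ℝ[X]} (hE : Exponents m lam mu)
    (hq : IsLyapunovCoeffs m lam mu 1 q) (hmu : 0 < mu) (hlt : mu < lam) (C₁ C₂ : ℝ) :
    (fun x => realSeries lam mu q C₁ C₂ (Real.log x)) ~[𝓝[>] 0]
      (fun x => C₁ * x ^ lam + C₂ * x ^ mu) := by
  refine isEquivalent_log
    (v := fun u => C₁ * Real.exp (lam * u) + C₂ * Real.exp (mu * u)) ?_ ?_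
  · rcases eq_or_ne C₂ 0 with rfl | h2
    · rcases eq_or_ne C₁ 0 with rfl | h1
      · simp [realSeries_zero hq]
      -- the principal term is `C₁ x ^ lam`, so an error `o(x ^ mu)` would not suffice
      have h := realSeries_sub_realSeries_isLittleO hE hq (hmu.trans hlt) hmu C₁ 0 0
      have h3 := h.trans_isBigO (isBigO_const_mul_self C₁⁻¹ (fun u => C₁ * Real.exp (lam * u))
        atBot |>.congr_left fun u => by rw [← mul_assoc, inv_mul_cancel₀ h1, one_mul])
      simpa [realSeries_zero hq] using h3
    · refine (distinct_isLittleO hE hq hmu hlt C₁ C₂).trans_isBigO ?_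
      have h3 : (fun _ : ℝ => (1 : ℝ)) =O[atBot]
          fun u : ℝ => C₁ * Real.exp ((lam - mu) * u) + C₂ :=
        (isBigO_const_left_iff_pos_le_norm one_ne_zero).2 ⟨‖C₂‖ / 2, by positivity,
          (tendsto_exp_sub hlt C₁ C₂).norm.eventually_const_le
            (half_lt_self (norm_pos_iff.2 h2))⟩
      have h4 := (isBigO_refl (fun u : ℝ => Real.exp (mu * u)) atBot).mul h3
      simp only [mul_one] at h4
      exact h4.congr_right fun u => (exp_combination lam mu C₁ C₂ u).symm
  · filter_upwards [exp_mul_log_eventuallyEq lam, exp_mul_log_eventuallyEq mu] with x h1 h2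
    rw [h1, h2]

lemma distinct_injective {q : ℕ → ℕ → ℝ[X]} (hE : Exponents m lam mu)
    (hq : IsLyapunovCoeffs m lam mu 1 q) (hmu : 0 < mu) (hlt : mu < lam) {C₁ C₂ C₁' C₂' : ℝ}
    (h : realSeries lam mu q C₁ C₂ =ᶠ[atBot] realSeries lam mu q C₁' C₂') :
    C₁ = C₁' ∧ C₂ = C₂' := by
  have h1 := isLittleO_principal_sub (distinct_isLittleO hE hq hmu hlt C₁ C₂)
    (distinct_isLittleO hE hq hmu hlt C₁' C₂') h
  have h2 : Tendsto (fun u : ℝ => (C₁ - C₁') * Real.exp ((lam - mu) * u) + (C₂ - C₂')) atBot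
      (𝓝 0) := by
    refine tendsto_zero_of_exp_mul_isLittleO (a := mu) (h1.congr_left fun u => ?_)
    rw [exp_combination, exp_combination]
    ring
  have e2 : C₂ = C₂' :=
    sub_eq_zero.1 (tendsto_nhds_unique (tendsto_exp_sub hlt _ _) h2)
  subst e2
  refine ⟨?_, rfl⟩
  have h3 := realSeries_sub_realSeries_isLittleO hE hq (hmu.trans hlt) hmu C₁ C₁' C₂
  have h4 : Tendsto (fun _ : ℝ => C₁ - C₁') atBot (𝓝 0) := by
    refine tendsto_zero_of_exp_mul_isLittleO (a := lam) (h3.neg_left.congr' ?_ EventuallyEq.rfl)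
    filter_upwards [h] with u hu
    rw [hu]
    ring
  exact sub_eq_zero.1 (tendsto_nhds_unique tendsto_const_nhds h4)

end IsLyapunovCoeffs

/-! ### Complex exponents -/

section ComplexExponents

variable {m a b : ℝ} {q : ℕ → ℕ → ℂ[X]}

/-- The sum of the Lyapunov series with exponents `a ± i b` and real parameters `C₁`, `C₂`, in the
variable `u = ln x`. -/
def oscSeries (a b : ℝ) (q : ℕ → ℕ → ℂ[X]) (C₁ C₂ u : ℝ) : ℝ :=
  (series (a + b * Complex.I) (a - b * Complex.I) ((C₁ - C₂ * Complex.I) / 2)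
    ((C₁ + C₂ * Complex.I) / 2) q u).re

lemma series_im_eq_zero {lam mu c₁ c₂ : ℂ} (hlam : starRingEnd ℂ lam = mu)
    (hc : starRingEnd ℂ c₁ = c₂) (hq : ∀ k l, (q k l).map (starRingEnd ℂ) = q l k) (u : ℝ) :
    (series lam mu c₁ c₂ q u).im = 0 := by
  have hmu : starRingEnd ℂ mu = lam := by rw [← hlam, Complex.conj_conj]
  have hc' : starRingEnd ℂ c₂ = c₁ := by rw [← hc, Complex.conj_conj]
  have hterm : ∀ n : ℕ × ℕ, starRingEnd ℂ (term lam mu c₁ c₂ q u n)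
      = term lam mu c₁ c₂ q u (Equiv.prodComm ℕ ℕ n) := by
    rintro ⟨k, l⟩
    have he : starRingEnd ℂ ((q k l).eval (u : ℂ)) = (q l k).eval (u : ℂ) := by
      rw [← hq k l, eval_map, ← Complex.conj_ofReal u, eval₂_hom, Complex.conj_ofReal]
    simp only [term, Equiv.prodComm_apply, Prod.swap_prod_mk, map_mul, map_pow, he, hc, hc',
      ← Complex.exp_conj, map_add, hlam, hmu, Complex.conj_ofReal, map_natCast]
    rw [add_comm ((k : ℂ) * mu)]
    ring
  rw [← Complex.conj_eq_iff_im, series, Complex.conj_tsum]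
  simp only [hterm]
  exact (Equiv.prodComm ℕ ℕ).tsum_eq (term lam mu c₁ c₂ q u)

/-- Complex conjugation exchanges the two exponents, so uniqueness of the coefficients makes the
family conjugation symmetric. -/
lemma coeffs_conj_symmetric
    (hE : Exponents (m : ℂ) (a + b * Complex.I) (a - b * Complex.I)) (ha : 0 < a)
    (hq : IsLyapunovCoeffs (m : ℂ) (a + b * Complex.I) (a - b * Complex.I) 1 q) (k l : ℕ) :
    (q k l).map (starRingEnd ℂ) = q l k := by
  have h1 := hq.map (starRingEnd ℂ)
  have e1 : starRingEnd ℂ ((a : ℂ) + b * Complex.I) = a - b * Complex.I := by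
    simp [sub_eq_add_neg]
  have e2 : starRingEnd ℂ ((a : ℂ) - b * Complex.I) = a + b * Complex.I := by
    simp [sub_eq_add_neg]
  rw [e1, e2, Complex.conj_ofReal, Polynomial.map_one] at h1
  have h2 := h1.swap fun k hk h0 => by
    have h3 := congrArg Complex.re h0
    simp at h3
    have h4 : (2 : ℝ) ≤ k := by exact_mod_cast hk
    nlinarith
  obtain ⟨q₀, -, hu⟩ := hE.existsUnique_coeffs (charOp_one _ _)
  have h3 := (hu _ h2).trans (hu _ hq).symm
  exact congrFun (congrFun h3 l) k

lemma principal_osc (a b C₁ C₂ u : ℝ) :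
    (C₁ - C₂ * Complex.I) / 2 * Complex.exp ((a + b * Complex.I) * u)
      + (C₁ + C₂ * Complex.I) / 2 * (Complex.exp ((a - b * Complex.I) * u) * 1)
    = ((Real.exp (a * u) * (C₁ * Real.cos (b * u) + C₂ * Real.sin (b * u)) : ℝ) : ℂ) := by
  have h1 : Complex.exp ((a + b * Complex.I) * u)
      = Complex.exp (a * u) * (Complex.cos (b * u) + Complex.sin (b * u) * Complex.I) := by
    rw [← Complex.exp_mul_I, ← Complex.exp_add]
    ring_nf
  have h2 : Complex.exp ((a - b * Complex.I) * u)
      = Complex.exp (a * u) * (Complex.cos (b * u) - Complex.sin (b * u) * Complex.I) := by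
    have := Complex.exp_mul_I (-(b * u : ℂ))
    rw [Complex.cos_neg, Complex.sin_neg, neg_mul (Complex.sin _), ← sub_eq_add_neg] at this
    rw [← this, ← Complex.exp_add]
    ring_nf
  rw [h1, h2]
  push_cast
  linear_combination (-(C₂ : ℂ) * Complex.exp (a * u) * Complex.sin (b * u)) * Complex.I_sq

lemma osc_geomBounded (hE : Exponents (m : ℂ) (a + b * Complex.I) (a - b * Complex.I))
    (ha : 0 < a)
    (hq : IsLyapunovCoeffs (m : ℂ) (a + b * Complex.I) (a - b * Complex.I) 1 q) :
    GeomBounded q :=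
  hq.geomBounded hE ha (by simp) (by simp)

lemma oscSeries_im (hE : Exponents (m : ℂ) (a + b * Complex.I) (a - b * Complex.I)) (ha : 0 < a)
    (hq : IsLyapunovCoeffs (m : ℂ) (a + b * Complex.I) (a - b * Complex.I) 1 q)
    (C₁ C₂ u : ℝ) : (series (a + b * Complex.I) (a - b * Complex.I) ((C₁ - C₂ * Complex.I) / 2)
      ((C₁ + C₂ * Complex.I) / 2) q u).im = 0 :=
  series_im_eq_zero (by simp [sub_eq_add_neg])
    (by rw [map_div₀, Complex.conj_ofNat]; simp)
    (coeffs_conj_symmetric hE ha hq) u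

lemma oscSeries_eventually_hasSum
    (hE : Exponents (m : ℂ) (a + b * Complex.I) (a - b * Complex.I)) (ha : 0 < a)
    (hq : IsLyapunovCoeffs (m : ℂ) (a + b * Complex.I) (a - b * Complex.I) 1 q) (C₁ C₂ : ℝ) :
    ∀ᶠ x : ℝ in 𝓝[>] 0, HasSum (fun n : ℕ × ℕ =>
      (q n.1 n.2).eval (Real.log x : ℂ) * ((C₁ - C₂ * Complex.I) / 2) ^ n.1 *
        ((C₁ + C₂ * Complex.I) / 2) ^ n.2 * (x : ℂ) ^ ((n.1 : ℂ) * (a + b * Complex.I)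
          + (n.2 : ℂ) * (a - b * Complex.I))) ((oscSeries a b q C₁ C₂ (Real.log x) : ℝ) : ℂ) := by
  have h := (osc_geomBounded hE ha hq).eventually_hasSum (lam := a + b * Complex.I)
    (mu := a - b * Complex.I) (by simpa using ha) (by simpa using ha)
    ((C₁ - C₂ * Complex.I) / 2) ((C₁ + C₂ * Complex.I) / 2)
  filter_upwards [Real.tendsto_log_nhdsGT_zero.eventually h, self_mem_nhdsWithin] with x hx hx0
  have hreal : ((oscSeries a b q C₁ C₂ (Real.log x) : ℝ) : ℂ)
      = series (a + b * Complex.I) (a - b * Complex.I) ((C₁ - C₂ * Complex.I) / 2)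
      ((C₁ + C₂ * Complex.I) / 2) q (Real.log x) :=
    Complex.ext (by simp [oscSeries]) (by rw [oscSeries_im hE ha hq, Complex.ofReal_im])
  rw [hreal]
  refine hx.congr_fun fun n => ?_
  have hx1 : (x : ℂ) ≠ 0 := Complex.ofReal_ne_zero.2 (ne_of_gt hx0)
  rw [Complex.cpow_def_of_ne_zero hx1, ← Complex.ofReal_log (le_of_lt hx0), term,
    mul_comm (Real.log x : ℂ)]
  ring

theorem oscSeries_solves (hm : 0 < m)
    (hE : Exponents (m : ℂ) (a + b * Complex.I) (a - b * Complex.I)) (ha : 0 < a)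
    (hq : IsLyapunovCoeffs (m : ℂ) (a + b * Complex.I) (a - b * Complex.I) 1 q) (C₁ C₂ : ℝ) :
    ∃ δ : ℝ, 0 < δ ∧ SolvesSingularCP m δ (fun x => oscSeries a b q C₁ C₂ (Real.log x)) ∧
      ∀ τp : ℝ, IsBlowUpSolution m τp δ (fun τ => 6 * m / ((m + 1) * (τ - τp)) *
        (1 + oscSeries a b q C₁ C₂ (Real.log |τ - τp|))) := by
  obtain ⟨U, hU⟩ := hq.exists_logSolution (osc_geomBounded hE ha hq) (by simpa using ha)
    (by simpa using ha) ((C₁ - C₂ * Complex.I) / 2) ((C₁ + C₂ * Complex.I) / 2)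
    (Eventually.of_forall fun u => oscSeries_im hE ha hq C₁ C₂ u)
  exact ⟨Real.exp U, Real.exp_pos U, hU.solvesSingularCP, hU.isBlowUpSolution hm⟩

lemma oscSeries_isLittleO (hE : Exponents (m : ℂ) (a + b * Complex.I) (a - b * Complex.I))
    (ha : 0 < a) (hq : IsLyapunovCoeffs (m : ℂ) (a + b * Complex.I) (a - b * Complex.I) 1 q)
    (C₁ C₂ : ℝ) :
    (fun u : ℝ => oscSeries a b q C₁ C₂ u -
      Real.exp (a * u) * (C₁ * Real.cos (b * u) + C₂ * Real.sin (b * u)))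
      =o[atBot] fun u => Real.exp (a * u) := by
  have h := re_isLittleO (hq.series_sub_principal_isLittleO (osc_geomBounded hE ha hq)
    ha (by simp) (by simp) ((C₁ - C₂ * Complex.I) / 2) ((C₁ + C₂ * Complex.I) / 2))
  refine h.congr_left fun u => ?_
  rw [eval_one, principal_osc, Complex.sub_re, Complex.ofReal_re, oscSeries]

lemma oscSeries_injective (hE : Exponents (m : ℂ) (a + b * Complex.I) (a - b * Complex.I))
    (ha : 0 < a) (hb : 0 < b)
    (hq : IsLyapunovCoeffs (m : ℂ) (a + b * Complex.I) (a - b * Complex.I) 1 q)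
    {C₁ C₂ C₁' C₂' : ℝ} (h : oscSeries a b q C₁ C₂ =ᶠ[atBot] oscSeries a b q C₁' C₂') :
    C₁ = C₁' ∧ C₂ = C₂' := by
  have h1 := isLittleO_principal_sub (oscSeries_isLittleO hE ha hq C₁ C₂)
    (oscSeries_isLittleO hE ha hq C₁' C₂') h
  obtain ⟨e1, e2⟩ := eq_zero_of_tendsto_trig (D₁ := C₁ - C₁') (D₂ := C₂ - C₂') hb
    (tendsto_zero_of_exp_mul_isLittleO (a := a) (h1.congr_left fun u => by ring))
  exact ⟨sub_eq_zero.1 e1, sub_eq_zero.1 e2⟩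

end ComplexExponents

/-- Without resonances the recursion never leaves the constants. -/
lemma IsLyapunovCoeffs.natDegree_eq_zero {𝕜 : Type*} [Field 𝕜] {m lam mu : 𝕜}
    {q : ℕ → ℕ → 𝕜[X]} (hE : Exponents m lam mu) (hq : IsLyapunovCoeffs m lam mu 1 q)
    (hres : ∀ l : ℕ, (l : 𝕜) * mu ≠ lam) (k l : ℕ) : (q k l).natDegree = 0 := by
  have h := hq.natDegree_le hE (n₀ := 2) (d := 0) (fun k l h => ?_) le_rfl
    (fun k l h h0 => ?_) k l
  · simpa using h
  · obtain ⟨rfl, rfl⟩ | ⟨rfl, rfl⟩ | ⟨rfl, rfl⟩ :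
      (k = 0 ∧ l = 0) ∨ (k = 1 ∧ l = 0) ∨ (k = 0 ∧ l = 1) := by omega
    · simp [hq.zero]
    · simp [hq.principal₁]
    · simp [hq.principal₂]
  · have hk := hE.resonance k l h h0
    subst hk
    exact hres l (by simpa [sub_eq_zero] using h0)

end BlowUp

end

theorem proposition7 (m : ℝ) (hm : 0 < m) :
    1 / 2 < mCrit ∧
    ∃ Y : ℝ → ℝ → ℝ → ℝ,
      -- distinct parameters give distinct solutions, arbitrarily close to the singular point
      (∀ C₁ C₂ C₁' C₂' : ℝ, Y C₁ C₂ =ᶠ[𝓝[>] 0] Y C₁' C₂' → C₁ = C₁' ∧ C₂ = C₂') ∧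
      -- the singular Cauchy problem and the blow-up solutions of the third-order equation
      (∀ C₁ C₂ : ℝ, ∃ δ : ℝ, 0 < δ ∧ SolvesSingularCP m δ (Y C₁ C₂) ∧
        ∀ τp : ℝ, IsBlowUpSolution m τp δ
          (fun τ => 6 * m / ((m + 1) * (τ - τp)) * (1 + Y C₁ C₂ |τ - τp|))) ∧
      -- complex exponents
      (mCrit < m →
        0 < alpha m ∧ 0 < beta m ∧
        (∀ C₁ C₂ : ℝ,
          (fun x => Y C₁ C₂ x - x ^ alpha m *
              (C₁ * Real.cos (beta m * Real.log x) + C₂ * Real.sin (beta m * Real.log x)))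
            =o[𝓝[>] 0] (fun x => x ^ alpha m)) ∧
        ∃ h : ℕ → ℕ → ℂ,
          IsLyapunovCoeffs (m : ℂ) (alpha m + beta m * Complex.I)
            (alpha m - beta m * Complex.I) 1 (fun k l => Polynomial.C (h k l)) ∧
          (∀ q, IsLyapunovCoeffs (m : ℂ) (alpha m + beta m * Complex.I)
            (alpha m - beta m * Complex.I) 1 q → ∀ k l, q k l = Polynomial.C (h k l)) ∧
          ∀ C₁ C₂ : ℝ, ∀ᶠ x : ℝ in 𝓝[>] 0,
            HasSum (fun n : ℕ × ℕ =>
              h n.1 n.2 * ((C₁ - C₂ * Complex.I) / 2) ^ n.1 * ((C₁ + C₂ * Complex.I) / 2) ^ n.2 *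
                (x : ℂ) ^ ((n.1 : ℂ) * (alpha m + beta m * Complex.I)
                  + (n.2 : ℂ) * (alpha m - beta m * Complex.I)))
              ((Y C₁ C₂ x : ℝ) : ℂ)) ∧
      -- a double exponent
      (m = mCrit →
        0 < alpha m ∧
        (∀ C₁ C₂ : ℝ,
          Y C₁ C₂ ~[𝓝[>] 0] (fun x => x ^ alpha m * (C₁ + C₂ * Real.log x))) ∧
        ∃ q : ℕ → ℕ → Polynomial ℝ,
          IsLyapunovCoeffs m (alpha m) (alpha m) Polynomial.X q ∧
          (∀ q', IsLyapunovCoeffs m (alpha m) (alpha m) Polynomial.X q' → q' = q) ∧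
          ∀ C₁ C₂ : ℝ, ∀ᶠ x : ℝ in 𝓝[>] 0,
            HasSum (fun n : ℕ × ℕ =>
              C₁ ^ n.1 * C₂ ^ n.2 * x ^ ((n.1 : ℝ) * alpha m + (n.2 : ℝ) * alpha m) *
                (q n.1 n.2).eval (Real.log x))
              (Y C₁ C₂ x)) ∧
      -- two real exponents
      (m < mCrit →
        0 < lam₂ m ∧ lam₂ m < lam₁ m ∧
        (∀ C₁ C₂ : ℝ,
          Y C₁ C₂ ~[𝓝[>] 0] (fun x => C₁ * x ^ lam₁ m + C₂ * x ^ lam₂ m)) ∧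
        ∃ q : ℕ → ℕ → Polynomial ℝ,
          IsLyapunovCoeffs m (lam₁ m) (lam₂ m) 1 q ∧
          (∀ q', IsLyapunovCoeffs m (lam₁ m) (lam₂ m) 1 q' → q' = q) ∧
          ((∀ n : ℕ, (n : ℝ) * lam₂ m ≠ lam₁ m) → ∀ k l, (q k l).natDegree = 0) ∧
          ∀ C₁ C₂ : ℝ, ∀ᶠ x : ℝ in 𝓝[>] 0,
            HasSum (fun n : ℕ × ℕ =>
              C₁ ^ n.1 * C₂ ^ n.2 * x ^ ((n.1 : ℝ) * lam₁ m + (n.2 : ℝ) * lam₂ m) *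
                (q n.1 n.2).eval (Real.log x))
              (Y C₁ C₂ x)) := by
  refine ⟨one_half_lt_mCrit, ?_⟩
  rcases lt_trichotomy m mCrit with h | h | h
  · have hlt := lam₂_lt_lam₁ hm h
    have hpos := lam₂_pos hm h
    have hE := exponents_real hm (lam_add hm) (lam_mul hm h) hpos hlt.le
    obtain ⟨q, hq, hqu⟩ := hE.existsUnique_coeffs (charOp_one _ _)
    refine ⟨fun C₁ C₂ x => realSeries (lam₁ m) (lam₂ m) q C₁ C₂ (Real.log x), ?_, ?_,
      fun h' => absurd h' h.not_gt, fun h' => absurd h' h.ne, fun _ => ⟨hpos, hlt, ?_, q, hq,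
        fun q' hq' => hqu q' hq', hq.natDegree_eq_zero hE, ?_⟩⟩
    · intro C₁ C₂ C₁' C₂' he
      exact hq.distinct_injective hE hpos hlt (eventuallyEq_atBot_of_nhdsGT he)
    · exact hq.realSeries_solves hm hE (hpos.trans hlt) hpos
    · exact hq.distinct_isEquivalent hE hpos hlt
    · exact hq.eventually_hasSum_rpow hE (hpos.trans hlt) hpos
  · have hpos := alpha_pos hm
    have hE := exponents_real hm (two_alpha hm) (alpha_sq_of_eq hm h) hpos le_rfl
    obtain ⟨q, hq, hqu⟩ := hE.existsUnique_coeffs (charOp_X _)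
    refine ⟨fun C₁ C₂ x => realSeries (alpha m) (alpha m) q C₁ C₂ (Real.log x), ?_, ?_,
      fun h' => absurd h h'.ne', fun _ => ⟨hpos, ?_, q, hq, fun q' hq' => hqu q' hq', ?_⟩,
      fun h' => absurd h h'.ne⟩
    · intro C₁ C₂ C₁' C₂' he
      exact hq.double_injective hE hpos (eventuallyEq_atBot_of_nhdsGT he)
    · exact hq.realSeries_solves hm hE hpos hpos
    · exact hq.double_isEquivalent hE hpos
    · exact hq.eventually_hasSum_rpow hE hpos hpos
  · have ha := alpha_pos hm
    have hb := beta_pos hm h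
    have hE := exponents_complex hm h
    obtain ⟨q, hq, hqu⟩ := hE.existsUnique_coeffs (charOp_one _ _)
    have hres : ∀ l : ℕ, (l : ℂ) * (alpha m - beta m * Complex.I)
        ≠ alpha m + beta m * Complex.I := by
      intro l h0
      have h1 := congrArg Complex.re h0
      have h2 := congrArg Complex.im h0
      simp at h1 h2
      -- equal real parts force `l = 1`, and then the imaginary parts differ
      have h3 : (l : ℝ) = 1 := by
        have : ((l : ℝ) - 1) * alpha m = 0 := by linarith
        rcases mul_eq_zero.1 this with h | h
        · linarith
        · exact absurd h ha.ne'
      rw [h3] at h2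
      linarith
    have hC : ∀ k l, q k l = Polynomial.C ((q k l).coeff 0) := fun k l =>
      eq_C_of_natDegree_eq_zero (hq.natDegree_eq_zero hE hres k l)
    have hqC : (fun k l => Polynomial.C ((q k l).coeff 0)) = q := by
      funext k l
      exact (hC k l).symm
    refine ⟨fun C₁ C₂ x => oscSeries (alpha m) (beta m) q C₁ C₂ (Real.log x), ?_, ?_,
      fun _ => ⟨ha, hb, ?_, fun k l => (q k l).coeff 0, ?_, ?_, ?_⟩, fun h' => absurd h' h.ne',
      fun h' => absurd h' h.not_gt⟩
    · intro C₁ C₂ C₁' C₂' he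
      exact oscSeries_injective hE ha hb hq (eventuallyEq_atBot_of_nhdsGT he)
    · exact oscSeries_solves hm hE ha hq
    · intro C₁ C₂
      refine ((oscSeries_isLittleO hE ha hq C₁ C₂).comp_tendsto
        Real.tendsto_log_nhdsGT_zero).congr' ?_ (exp_mul_log_eventuallyEq (alpha m))
      filter_upwards [exp_mul_log_eventuallyEq (alpha m)] with x hx
      simp only [Function.comp_apply, hx]
    · rw [hqC]
      exact hq
    · intro q' hq' k l
      rw [hqu q' hq']
      exact hC k l
    · intro C₁ C₂
      filter_upwards [oscSeries_eventually_hasSum hE ha hq C₁ C₂] with x hx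
      refine hx.congr_fun fun n => ?_
      rw [hC n.1 n.2, eval_C, coeff_C_zero]
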